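/- **Setting.** For a finite database $D=(x_1,\dots,x_n)$ of points of a metric space $(\mathcal X,d)$ and a query point $y\in\mathcal X$ put $D(y)=\frac1n\sum_{i=1}^n d(x_i,y)$. Databases are adjacent if they differ in at most one entry. An interactive mechanism answers $k$ queries one after the other, each answer depending on the database, on internal randomness and on the queries so far; it is $(\varepsilon,\delta)$-differentially private if for every adaptive analyst, all adjacent $D_1,D_2$ and all measurable sets $S$ of transcripts (queries and answers), $\Pr[\text{transcript on }D_1\in S]\le e^{\varepsilon}\Pr[\text{transcript on }D_2\in S]+\delta$. A non-interactive mechanism releases a random synopsis from which every query can be answered without further access to the database; it is $(\varepsilon,\delta)$-differentially private if the same inequality holds for the law of the synopsis. "$\varepsilon$-differentially private" means $\delta=0$. A mechanism for the cube $([0,1]^\ell,\|\cdot\|_1)$ is $(\alpha,\beta)$-accurate if, for every database $D$ and every family $Q$ of queries ($k$ queries in the interactive case, an arbitrary set in the non-interactive case) such that every query is within distance $1$ of every data point, with probability at least $1-\beta$ every $y\in Q$ is answered up to an additive error $\alpha$ from $D(y)$. For $\pi:\mathcal X\to[0,1]^\ell$ and queries $Q$ in $\mathcal X$, the expansion of $\pi$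 is $\sup_{x\in\mathcal X,\,y\in Q}\|\pi(x)-\pi(y)\|_1/d(x,y)$ and its contraction is $\sup_{x\in\mathcal X,\,y\in Q}d(x,y)/\|\pi(x)-\pi(y)\|_1$ (with $0/0=0$ and $a/0=\infty$ for $a>0$). Given a mechanism $M$ for the cube, let $M_\pi$ be the mechanism for $\mathcal X$ that runs $M$ on the proxy database $(\pi(x_1),\dots,\pi(x_n))$ and releases its answer to $\pi(y)$ as the answer to $y$. Say that $M$ is $(\alpha,\beta)$-accurate via embeddings if for every metric space $(\mathcal X,d)$ of diameter at most $1$, every database $D\in\mathcal X^n$, all queries $Q$ in $\mathcal X$ ($k$ of them in the interactive case, an arbitrary set in the non-interactive case) and every $\pi:\mathcal X\to[0,1]^\ell$ with expansion at most $1$ and contraction at most $C$, with probability at least $1-\beta$, $$\frac1C\,D(y)-\alpha\;\le\;M_\pi(D,y)\;\le\;D(y)+\alpha\qquad\text{for every }y\in Q .$$ **Theorem.** (a) Every interactive or non-interactive mechanism for $([0,1]^\ell,\|\cdot\|_1)$ that is $(\alpha,\beta)$-accurate is $(\alpha,\beta)$-accurate via embeddings. (b) There is a universal constant $K>0$ such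 that for all integers $\ell,n\ge1$ and all $\varepsilon>0$, $0<\beta<1$: 1. for all $k\ge1$ and $0<\delta<1$ there is an $(\varepsilon,\delta)$-differentially private interactive mechanism for $k$ queries on $([0,1]^\ell,\|\cdot\|_1)$ that is $(\alpha,\beta)$-accurate and $(\alpha,\beta)$-accurate via embeddings, with $$\alpha=K\,\frac{\ell^{9/5}\log^{4/5}(4/\delta)\log^{4/5}(k/\beta)}{n^{4/5}\varepsilon^{4/5}};$$ 2. for all $k\ge1$ there is an $\varepsilon$-differentially private interactive mechanism for $k$ queries with both properties, with $$\alpha=K\,\frac{\ell^{7/3}\log^{2/3}(k/\beta)}{n^{2/3}\varepsilon^{2/3}};$$ 3. for all $0<\delta<1$ there is an $(\varepsilon,\delta)$-differentially private non-interactive mechanism with both properties, with $\alpha$ as in 1 but with $\log(n\ell/\beta)$ in place of $\log(k/\beta)$; 4. there is an $\varepsilon$-differentially private non-interactive mechanism with both properties, with $\alpha$ as in 2 but with $\log(n\ell/\beta)$ in place of $\log(k/\beta)$. -/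

import Mathlib

open MeasureTheory

/-- The metric space `([0,1]^ℓ, ‖·‖₁)`. -/
abbrev L1Cube (ℓ : ℕ) : Type :=
  {v : PiLp 1 (fun _ : Fin ℓ => ℝ) // ∀ i, v i ∈ Set.Icc (0 : ℝ) 1}

/-- The exact answer to the distance query `y` on the database `D`: the average distance from `y`
to the `n` data points. -/
noncomputable def avgDist {n : ℕ} {X : Type*} [MetricSpace X] (D : Fin n → X) (y : X) : ℝ :=
  (1 / (n : ℝ)) * ∑ i, dist (D i) y

/-- Two databases are adjacent if they differ in at most one entry. -/
def Adjacent {n : ℕ} {X : Type*} (D₁ D₂ : Fin n → X) : Prop :=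
  {i | D₁ i ≠ D₂ i}.ncard ≤ 1

/-- `(ε, δ)`-indistinguishability of two output laws. -/
def Indistinguishable {Z : Type*} [MeasurableSpace Z] (ε δ : ℝ) (μ ν : Measure Z) : Prop :=
  ∀ S : Set Z, MeasurableSet S →
    μ S ≤ ENNReal.ofReal (Real.exp ε) * ν S + ENNReal.ofReal δ

/-- `p` holds with probability at least `1 - β`, written as: `p` fails with probability at most
`β`. (For a probability measure and a measurable event the two are the same; the second form is
meaningful, through the outer measure, without a measurability proof.) -/
def HoldsExceptWithProb {Ω : Type*} [MeasurableSpace Ω] (μ : Measure Ω) (p : Ω → Prop)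
    (β : ℝ) : Prop :=
  μ {ω | ¬ p ω} ≤ ENNReal.ofReal β

/-! ### Embeddings -/

/-- Expansion of `π` relative to the query points `Q`: the supremum of `d'(π x, π y) / d(x, y)`
over all `x ∈ X`, `y ∈ Q`. In `ℝ≥0∞` one has `0 / 0 = 0` and `a / 0 = ∞` for `a ≠ 0`. -/
noncomputable def expansion {X Y : Type*} [MetricSpace X] [MetricSpace Y] (π : X → Y)
    (Q : Set X) : ENNReal :=
  ⨆ x : X, ⨆ y ∈ Q, edist (π x) (π y) / edist x y

/-- Contraction of `π` relative to the query points `Q`: the supremum of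
`d(x, y) / d'(π x, π y)` over all `x ∈ X`, `y ∈ Q`. -/
noncomputable def contraction {X Y : Type*} [MetricSpace X] [MetricSpace Y] (π : X → Y)
    (Q : Set X) : ENNReal :=
  ⨆ x : X, ⨆ y ∈ Q, edist x y / edist (π x) (π y)

/-! ### Interactive mechanisms -/

/-- An interactive query release mechanism for databases of `n` points of `X`, with internal
randomness `ω`. `answer D j q ω` is the answer to the query `q j` after the earlier queries
`q 0, …, q (j - 1)`: it may depend on the database, on the randomness and on the queries so far
(hence on the answers so far), but not on future queries. -/
structure InteractiveMechanism (n : ℕ) (X : Type*) where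
  Ω : Type
  [mΩ : MeasurableSpace Ω]
  P : Measure Ω
  [isProb : IsProbabilityMeasure P]
  answer : (Fin n → X) → (j : ℕ) → (Fin (j + 1) → X) → Ω → ℝ
  measurable_answer : ∀ D j q, Measurable (answer D j q)

attribute [instance] InteractiveMechanism.mΩ InteractiveMechanism.isProb

namespace InteractiveMechanism

variable {n : ℕ} {X Y : Type*}

/-- The answers are measurable jointly in the randomness and in the queries. -/
def IsMeasurable [MeasurableSpace X] (M : InteractiveMechanism n X) : Prop :=
  ∀ D j, Measurable fun p : (Fin (j + 1) → X) × M.Ω => M.answer D j p.1 p.2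

/-- The answer to the `j`-th query when the queries `Q 0, Q 1, …` are asked in this order. -/
def run (M : InteractiveMechanism n X) (D : Fin n → X) {k : ℕ} (Q : Fin k → X) (j : Fin k)
    (ω : M.Ω) : ℝ :=
  M.answer D j (fun i => Q (Fin.castLE j.isLt i)) ω

/-- The transcript (queries and answers) of the first `j` rounds of the interaction with an
adaptive analyst, who chooses the next query as a function of the answers received so far. -/
def transcript (M : InteractiveMechanism n X) (D : Fin n → X)
    (analyst : (j : ℕ) → (Fin j → ℝ) → X) (ω : M.Ω) : (j : ℕ) → Fin j → X × ℝ
  | 0 => Fin.elim0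
  | j + 1 =>
    let past := transcript M D analyst ω j
    let y : X := analyst j (fun i => (past i).2)
    let queries : Fin (j + 1) → X := Fin.snoc (α := fun _ => X) (fun i => (past i).1) y
    Fin.snoc (α := fun _ => X × ℝ) past (y, M.answer D j queries ω)

/-- `(ε, δ)`-differential privacy for `k` adaptively chosen queries: for adjacent databases the
laws of the whole transcript are `(ε, δ)`-indistinguishable. (A randomized analyst is a mixture of
deterministic ones, so it is enough to consider the latter.) -/
def IsDifferentiallyPrivate [MeasurableSpace X] (M : InteractiveMechanism n X) (k : ℕ)
    (ε δ : ℝ) : Prop :=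
  ∀ analyst : (j : ℕ) → (Fin j → ℝ) → X, (∀ j, Measurable (analyst j)) →
    ∀ D₁ D₂ : Fin n → X, Adjacent D₁ D₂ →
      Indistinguishable ε δ
        (M.P.map fun ω => M.transcript D₁ analyst ω k)
        (M.P.map fun ω => M.transcript D₂ analyst ω k)

/-- `(α, β)`-accuracy for `k` distance queries with answers in the range `[0, 1]`: for all data and
queries such that every query is within distance `1` of every data point (as is the case inside
any subset of diameter at most `1`), with probability at least `1 - β` all `k` answers are correct
up to `α`. -/
def IsAccurate [MetricSpace X] (M : InteractiveMechanism n X) (k : ℕ) (α β : ℝ) : Prop :=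
  ∀ (D : Fin n → X) (Q : Fin k → X), (∀ i j, dist (D i) (Q j) ≤ 1) →
    HoldsExceptWithProb M.P (fun ω => ∀ j, |M.run D Q j ω - avgDist D (Q j)| ≤ α) β

/-- Releasing distance queries on `X` via the map `π : X → Y`: run the mechanism for `Y` on the
proxy database `π(D)` and, for a query `y`, release its answer to `π(y)`. -/
def viaEmbedding (M : InteractiveMechanism n Y) (π : X → Y) : InteractiveMechanism n X where
  Ω := M.Ω
  P := M.P
  answer D j q ω := M.answer (π ∘ D) j (π ∘ q) ω
  measurable_answer D j q := M.measurable_answer (π ∘ D) j (π ∘ q)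

/-- Used via any map `π` from any metric space of diameter at most `1` that has expansion at most
`1` and contraction at most `C` relative to the `k` queries, the mechanism answers, with
probability at least `1 - β`, every query `y` by a number between `(1 / C) * avgDist D y - α` and
`avgDist D y + α`. -/
def IsAccurateViaEmbeddings.{u, v} {n : ℕ} {Y : Type v} [MetricSpace Y]
    (M : InteractiveMechanism n Y) (k : ℕ) (α β : ℝ) : Prop :=
  ∀ (X : Type u) [MetricSpace X], (∀ x y : X, dist x y ≤ 1) →
    ∀ (D : Fin n → X) (Q : Fin k → X) (π : X → Y) (C : ℝ),
      expansion π (Set.range Q) ≤ 1 → contraction π (Set.range Q) ≤ ENNReal.ofReal C →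
      HoldsExceptWithProb (M.viaEmbedding π).P (fun ω => ∀ j : Fin k,
        1 / C * avgDist D (Q j) - α ≤ (M.viaEmbedding π).run D Q j ω ∧
        (M.viaEmbedding π).run D Q j ω ≤ avgDist D (Q j) + α) β

end InteractiveMechanism

/-! ### Non-interactive mechanisms -/

/-- A non-interactive query release mechanism for databases of `n` points of `X`: it releases a
random synopsis, from which every query `y` is answered, as `eval z y`, without further access to
the database. -/
structure OfflineMechanism (n : ℕ) (X : Type*) where
  Synopsis : Type
  [mSynopsis : MeasurableSpace Synopsis]
  release : (Fin n → X) → Measure Synopsis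
  [isProb : ∀ D, IsProbabilityMeasure (release D)]
  eval : Synopsis → X → ℝ
  measurable_eval : ∀ y, Measurable fun z => eval z y

attribute [instance] OfflineMechanism.mSynopsis OfflineMechanism.isProb

namespace OfflineMechanism

variable {n : ℕ} {X Y : Type*}

/-- The answers are measurable jointly in the synopsis and in the query. -/
def IsMeasurable [MeasurableSpace X] (M : OfflineMechanism n X) : Prop :=
  Measurable fun p : M.Synopsis × X => M.eval p.1 p.2

/-- `(ε, δ)`-differential privacy of the released synopsis. -/
def IsDifferentiallyPrivate (M : OfflineMechanism n X) (ε δ : ℝ) : Prop :=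
  ∀ D₁ D₂ : Fin n → X, Adjacent D₁ D₂ → Indistinguishable ε δ (M.release D₁) (M.release D₂)

/-- `(α, β)`-accuracy, simultaneously for all distance queries in any set `Q`, with answers in the
range `[0, 1]`. -/
def IsAccurate [MetricSpace X] (M : OfflineMechanism n X) (α β : ℝ) : Prop :=
  ∀ (D : Fin n → X) (Q : Set X), (∀ i, ∀ y ∈ Q, dist (D i) y ≤ 1) →
    HoldsExceptWithProb (M.release D) (fun z => ∀ y ∈ Q, |M.eval z y - avgDist D y| ≤ α) β

/-- Releasing distance queries on `X` via the map `π : X → Y`: run the mechanism for `Y` on the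
proxy database `π(D)` and answer a query `y` by evaluating the synopsis at `π(y)`. -/
def viaEmbedding (M : OfflineMechanism n Y) (π : X → Y) : OfflineMechanism n X where
  Synopsis := M.Synopsis
  release D := M.release (π ∘ D)
  isProb D := M.isProb (π ∘ D)
  eval z y := M.eval z (π y)
  measurable_eval y := M.measurable_eval (π y)

/-- The non-interactive counterpart of `InteractiveMechanism.IsAccurateViaEmbeddings`, for an
arbitrary set `Q` of queries. -/
def IsAccurateViaEmbeddings.{u, v} {n : ℕ} {Y : Type v} [MetricSpace Y]
    (M : OfflineMechanism n Y) (α β : ℝ) : Prop :=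
  ∀ (X : Type u) [MetricSpace X], (∀ x y : X, dist x y ≤ 1) →
    ∀ (D : Fin n → X) (Q : Set X) (π : X → Y) (C : ℝ),
      expansion π Q ≤ 1 → contraction π Q ≤ ENNReal.ofReal C →
      HoldsExceptWithProb ((M.viaEmbedding π).release D) (fun z => ∀ y ∈ Q,
        1 / C * avgDist D y - α ≤ (M.viaEmbedding π).eval z y ∧
        (M.viaEmbedding π).eval z y ≤ avgDist D y + α) β

end OfflineMechanism

/-! ### Additive error bounds -/

/-- `K ℓ^{9/5} log^{4/5}(4/δ) log^{4/5}(r/β) / (n ε)^{4/5}`. -/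
noncomputable def approxError (K : ℝ) (ℓ n r : ℕ) (ε δ β : ℝ) : ℝ :=
  K * ((ℓ : ℝ) ^ (9 / 5 : ℝ) * Real.log (4 / δ) ^ (4 / 5 : ℝ) * Real.log (r / β) ^ (4 / 5 : ℝ) /
    ((n : ℝ) ^ (4 / 5 : ℝ) * ε ^ (4 / 5 : ℝ)))

/-- `K ℓ^{7/3} log^{2/3}(r/β) / (n ε)^{2/3}`. -/
noncomputable def pureError (K : ℝ) (ℓ n r : ℕ) (ε β : ℝ) : ℝ :=
  K * ((ℓ : ℝ) ^ (7 / 3 : ℝ) * Real.log (r / β) ^ (2 / 3 : ℝ) /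
    ((n : ℝ) ^ (2 / 3 : ℝ) * ε ^ (2 / 3 : ℝ)))

universe u

-- Accuracy via embeddings is pointwise. Expansion at most `1` and contraction at most `C` sandwich
-- each proxy distance between `d / C` and `d`, hence also the averages, and expansion keeps proxy
-- queries within distance `1` of the proxy data.
--
-- For existence, one noisy synopsis answers all queries at once under pure privacy, with error of
-- order `ℓ² (log (ℓ / β) + 1) / (n ε)`. The `ℓ₁` distance splits over coordinates, and on `[0, 1]`
-- one has `|x - t| = t + x (1 - 2 t) - bridge x t`. By `bridge_self_similar`, `bridge` expands into
-- products of a hat in `x` and a hat in `t`, so the average distance is linear in averages of data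
-- coefficients. At each dyadic level at most one hat is nonzero at a given point, and level `j`
-- coefficients have size at most `2 ^ (-j) / 2`. With Laplace scales proportional to `(3/4) ^ j`,
-- the weighted sensitivity is governed by `∑ (2/3) ^ j` (`sum_distCoeff_div_scale_le`) and the
-- noise in one answer by `∑ (3/4) ^ j (j + 1)` (`abs_sum_noise_le`). Neither depends on the depth,
-- which is taken large enough to make truncation negligible. An adaptive transcript is
-- postprocessing of the noisy coefficients.
--
-- Clamping caps the error at `1`, and `min 1 (K w) ≤ K w ^ p` for `0 ≤ p ≤ 1` turns the bound
-- linear in `1 / (n ε)` into both claimed rates (`min_one_le_errors`). When the argument `r` of the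
-- logarithm is `1`, `log (r / β)` can be arbitrarily small and absorbs no constant; those cases use
-- a single noisy value.

universe v

/-! ### Laplace noise -/

/-- The centred Laplace distribution of scale `b`. -/
noncomputable def laplace (b : ℝ) : Measure ℝ :=
  volume.withDensity fun x => ENNReal.ofReal (1 / (2 * b) * Real.exp (-(|x| / b)))

lemma laplace_Ioi {b T : ℝ} (hb : 0 < b) (hT : 0 ≤ T) :
    laplace b (Set.Ioi T) = ENNReal.ofReal (Real.exp (-(T / b)) / 2) := by
  have ha : -(1 / b) < 0 := by simpa using hb
  rw [laplace, withDensity_apply _ measurableSet_Ioi,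
    setLIntegral_congr_fun (g := fun x => ENNReal.ofReal (1 / (2 * b) * Real.exp (-(1 / b) * x)))
      measurableSet_Ioi, ← ofReal_integral_eq_lintegral_ofReal,
    integral_const_mul, integral_exp_mul_Ioi ha]
  · congr 1
    rw [show -(1 / b) * T = -(T / b) by ring]
    field_simp
  · exact (integrableOn_exp_mul_Ioi ha T).const_mul _
  · exact Filter.Eventually.of_forall fun x => by positivity
  · intro x hx
    have : 0 < x := hT.trans_lt hx
    simp only [abs_of_pos this]
    congr 3
    ring

lemma laplace_Iic {b T : ℝ} (hb : 0 < b) (hT : 0 ≤ T) :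
    laplace b (Set.Iic (-T)) = ENNReal.ofReal (Real.exp (-(T / b)) / 2) := by
  have ha : 0 < 1 / b := by simpa using hb
  rw [laplace, withDensity_apply _ measurableSet_Iic,
    setLIntegral_congr_fun (g := fun x => ENNReal.ofReal (1 / (2 * b) * Real.exp (1 / b * x)))
      measurableSet_Iic, ← ofReal_integral_eq_lintegral_ofReal,
    integral_const_mul, integral_exp_mul_Iic ha]
  · congr 1
    rw [show 1 / b * -T = -(T / b) by ring]
    field_simp
  · exact (integrableOn_exp_mul_Iic ha _).const_mul _
  · exact Filter.Eventually.of_forall fun x => by positivity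
  · intro x hx
    have : x ≤ 0 := le_trans hx (by linarith)
    simp only [abs_of_nonpos this]
    congr 3
    ring

lemma isProbabilityMeasure_laplace {b : ℝ} (hb : 0 < b) : IsProbabilityMeasure (laplace b) := by
  refine ⟨?_⟩
  have h1 := laplace_Ioi hb le_rfl
  have h2 := laplace_Iic hb le_rfl
  rw [neg_zero] at h2
  rw [← Set.Iic_union_Ioi (a := (0 : ℝ)),
    measure_union (Set.Iic_disjoint_Ioi le_rfl) measurableSet_Ioi, h1, h2,
    ← ENNReal.ofReal_add (by positivity) (by positivity)]
  norm_num

lemma laplace_tail {b T : ℝ} (hb : 0 < b) (hT : 0 ≤ T) :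
    laplace b {x | T < |x|} ≤ ENNReal.ofReal (Real.exp (-(T / b))) := by
  have hsub : {x : ℝ | T < |x|} ⊆ Set.Iic (-T) ∪ Set.Ioi T := by
    intro x hx
    rcases lt_abs.1 (show T < |x| from hx) with h | h
    · exact Or.inr h
    · exact Or.inl (show x ≤ -T by linarith)
  refine (measure_mono hsub).trans ((measure_union_le _ _).trans_eq ?_)
  rw [laplace_Ioi hb hT, laplace_Iic hb hT, ← ENNReal.ofReal_add (by positivity) (by positivity),
    add_halves]

/-- The triangle inequality `|x| ≤ |x - m| + |m|` bounds the ratio of the shifted density to the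
original one. -/
lemma map_add_laplace_le {b : ℝ} (hb : 0 < b) (m : ℝ) :
    (laplace b).map (fun x => m + x) ≤ ENNReal.ofReal (Real.exp (|m| / b)) • laplace b := by
  have hmeas : ∀ c : ℝ, Measurable fun x : ℝ =>
      ENNReal.ofReal (1 / (2 * b) * Real.exp (-(|x - c| / b))) := fun c => by fun_prop
  have hmeas0 : Measurable fun x : ℝ =>
      ENNReal.ofReal (1 / (2 * b) * Real.exp (-(|x| / b))) := by fun_prop
  refine Measure.le_iff.2 fun S hS => ?_
  rw [Measure.map_apply (measurable_const_add m) hS, laplace, Measure.smul_apply, smul_eq_mul,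
    withDensity_apply _ (measurable_const_add m hS), withDensity_apply _ hS,
    ← lintegral_const_mul _ hmeas0]
  have h := (measurePreserving_add_left volume m).setLIntegral_comp_preimage hS (hmeas m)
  simp only [add_sub_cancel_left] at h
  rw [h]
  refine lintegral_mono fun x => ?_
  rw [← ENNReal.ofReal_mul (Real.exp_pos _).le]
  refine ENNReal.ofReal_le_ofReal ?_
  rw [mul_left_comm, ← Real.exp_add]
  refine mul_le_mul_of_nonneg_left (Real.exp_le_exp.2 ?_) (by positivity)
  have : |x| ≤ |x - m| + |m| := by simpa using abs_add_le (x - m) m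
  rw [← sub_nonneg,
    show |m| / b + -(|x| / b) - -(|x - m| / b) = (|x - m| + |m| - |x|) / b by ring]
  exact div_nonneg (by linarith) hb.le

/-- The product outer measure is the largest one bounded on boxes by the product of the factors, so
domination of the factors suffices; no finiteness is needed. -/
lemma measure_pi_mono {ι : Type*} [Fintype ι] {α : ι → Type*} [∀ i, MeasurableSpace (α i)]
    {μ ν : ∀ i, Measure (α i)} (h : ∀ i, μ i ≤ ν i) : Measure.pi μ ≤ Measure.pi ν := by
  refine Measure.le_iff.2 fun s hs => ?_
  rw [Measure.pi, Measure.pi, toMeasure_apply _ _ hs, toMeasure_apply _ _ hs]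
  refine (OuterMeasure.le_pi.2 fun t _ => ?_ : OuterMeasure.pi _ ≤ OuterMeasure.pi _) s
  exact (OuterMeasure.pi_pi_le _ _).trans (Finset.prod_le_prod' fun i _ => h i _)

/-- The product of centred Laplace distributions of scales `b i`. -/
noncomputable def laplacePi {ι : Type*} [Fintype ι] (b : ι → ℝ) : Measure (ι → ℝ) :=
  Measure.pi fun i => laplace (b i)

section
variable {ι : Type*} [Fintype ι] {b : ι → ℝ}

lemma isProbabilityMeasure_laplacePi (hb : ∀ i, 0 < b i) :
    IsProbabilityMeasure (laplacePi b) := by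
  have := fun i => isProbabilityMeasure_laplace (hb i)
  unfold laplacePi
  infer_instance

lemma map_add_laplacePi_le (hb : ∀ i, 0 < b i) (m : ι → ℝ) :
    (laplacePi b).map (fun x => m + x) ≤
      ENNReal.ofReal (Real.exp (∑ i, |m i| / b i)) • laplacePi b := by
  have := fun i => isProbabilityMeasure_laplace (hb i)
  have hf : ∀ i, AEMeasurable (fun x => m i + x) (laplace (b i)) :=
    fun i => (measurable_const_add (m i)).aemeasurable
  have : ∀ i, IsProbabilityMeasure ((laplace (b i)).map fun x => m i + x) :=
    fun i => Measure.isProbabilityMeasure_map (hf i)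
  have h1 := Measure.pi_map_pi (μ := fun i => laplace (b i)) hf
  -- Constants pulled out of the factors multiply, so their exponents add.
  have h2 : (Measure.pi fun i => ENNReal.ofReal (Real.exp (|m i| / b i)) • laplace (b i)) =
      ENNReal.ofReal (Real.exp (∑ i, |m i| / b i)) • laplacePi b := by
    have : ∀ i, SigmaFinite (ENNReal.ofReal (Real.exp (|m i| / b i)) • laplace (b i)) :=
      fun i => (Measure.smul_finite _ ENNReal.ofReal_ne_top).toSigmaFinite
    refine Measure.pi_eq fun s _ => ?_
    simp only [Measure.smul_apply, smul_eq_mul, Finset.prod_mul_distrib]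
    rw [laplacePi, Measure.pi_pi, Real.exp_sum,
      ENNReal.ofReal_prod_of_nonneg fun i _ => (Real.exp_pos _).le]
  rw [← h2]
  exact h1.le.trans (measure_pi_mono fun i => map_add_laplace_le (hb i) (m i))

lemma laplacePi_tail (hb : ∀ i, 0 < b i) {T : ι → ℝ} (hT : ∀ i, 0 ≤ T i) :
    laplacePi b {x | ∃ i, T i < |x i|} ≤ ENNReal.ofReal (∑ i, Real.exp (-(T i / b i))) := by
  have := fun i => isProbabilityMeasure_laplace (hb i)
  rw [Set.ofPred_exists, ENNReal.ofReal_sum_of_nonneg fun i _ => (Real.exp_pos _).le]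
  refine (measure_iUnion_fintype_le _ _).trans (Finset.sum_le_sum fun i _ => ?_)
  have h := (measurePreserving_eval (fun i => laplace (b i)) i).measure_preimage
    (s := {x | T i < |x|}) (measurableSet_lt measurable_const (by fun_prop)).nullMeasurableSet
  exact h.le.trans (laplace_tail (hb i) (hT i))

end

/-! ### Indistinguishability, postprocessing and the Laplace mechanism -/

lemma Indistinguishable.of_le {Z : Type*} [MeasurableSpace Z] {ε : ℝ} {μ ν : Measure Z}
    (h : μ ≤ ENNReal.ofReal (Real.exp ε) • ν) : Indistinguishable ε 0 μ ν := fun S _ => by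
  simpa using h S

lemma Indistinguishable.map {Z W : Type*} [MeasurableSpace Z] [MeasurableSpace W] {ε δ : ℝ}
    {μ ν : Measure Z} (h : Indistinguishable ε δ μ ν) {g : Z → W} (hg : Measurable g) :
    Indistinguishable ε δ (μ.map g) (ν.map g) := fun S hS => by
  rw [Measure.map_apply hg hS, Measure.map_apply hg hS]
  exact h _ (hg hS)

lemma Indistinguishable.mono {Z : Type*} [MeasurableSpace Z] {ε δ δ' : ℝ} {μ ν : Measure Z}
    (h : Indistinguishable ε δ μ ν) (hδ : δ ≤ δ') : Indistinguishable ε δ' μ ν :=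
  fun S hS => (h S hS).trans (by gcongr)

/-- The Laplace mechanism: adding Laplace noise hides changes that are small relative to the
scales. -/
lemma indistinguishable_laplacePi {ι : Type*} [Fintype ι] {b : ι → ℝ} (hb : ∀ i, 0 < b i)
    {f g : ι → ℝ} {ε : ℝ} (h : ∑ i, |f i - g i| / b i ≤ ε) :
    Indistinguishable ε 0 ((laplacePi b).map fun x => f + x)
      ((laplacePi b).map fun x => g + x) := by
  -- Comparing the shift by `f - g` with no shift is enough: translating both laws by `g` is
  -- postprocessing.
  have h0 : (laplacePi b).map (fun x => (f - g) + x) ≤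
      ENNReal.ofReal (Real.exp ε) • laplacePi b :=
    (map_add_laplacePi_le hb (f - g)).trans fun S => by
      simp only [Measure.smul_apply, smul_eq_mul]
      gcongr
      simpa using h
  have h1 := (Indistinguishable.of_le h0).map (measurable_const_add g)
  rw [Measure.map_map (measurable_const_add g) (measurable_const_add _)] at h1
  convert h1 using 2
  ext x : 1
  simp [← add_assoc]

/-- Postprocessing the output of the Laplace mechanism preserves privacy. -/
lemma indistinguishable_laplacePi_comp {ι W : Type*} [Fintype ι] [MeasurableSpace W] {b : ι → ℝ}
    (hb : ∀ i, 0 < b i) {f g : ι → ℝ} {ε : ℝ} (h : ∑ i, |f i - g i| / b i ≤ ε)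
    {G u v : (ι → ℝ) → W} (hG : Measurable G) (hu : ∀ ω, u ω = G (f + ω))
    (hv : ∀ ω, v ω = G (g + ω)) :
    Indistinguishable ε 0 ((laplacePi b).map u) ((laplacePi b).map v) := by
  have h1 := (indistinguishable_laplacePi hb h).map hG
  rw [Measure.map_map hG (measurable_const_add f), Measure.map_map hG (measurable_const_add g)]
    at h1
  rwa [funext hu, funext hv]

/-! ### The Faber–Schauder expansion of the distance on the unit interval -/

/-- The hat function on `[0, 1]` with peak `1` at `1 / 2`. -/
noncomputable def hat (s : ℝ) : ℝ := max 0 (1 - |2 * s - 1|)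

/-- `2 (min x t - x t)` on the unit square and `0` outside. It is the difference of `|x - t|` from
its linear interpolation in `t` between `0` and `1`. -/
noncomputable def bridge (x t : ℝ) : ℝ :=
  if x ∈ Set.Ioo (0 : ℝ) 1 ∧ t ∈ Set.Ioo (0 : ℝ) 1 then 2 * (min x t - x * t) else 0

lemma continuous_hat : Continuous hat := by unfold hat; fun_prop

lemma hat_nonneg (s : ℝ) : 0 ≤ hat s := le_max_left _ _

/-- The indicator form feeds `sum_le_of_localized`: integer translates of the open unit interval are
disjoint. -/
lemma hat_le (s : ℝ) : hat s ≤ if s ∈ Set.Ioo (0 : ℝ) 1 then 1 else 0 := by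
  unfold hat
  split_ifs with h
  · exact max_le zero_le_one (by linarith [abs_nonneg (2 * s - 1)])
  · refine max_le le_rfl ?_
    rw [Set.mem_Ioo, not_and_or, not_lt, not_lt] at h
    rcases h with h | h
    · linarith [neg_le_abs (2 * s - 1)]
    · linarith [le_abs_self (2 * s - 1)]

lemma bridge_eq {x t : ℝ} (hx : x ∈ Set.Icc (0 : ℝ) 1) (ht : t ∈ Set.Icc (0 : ℝ) 1) :
    bridge x t = 2 * (min x t - x * t) := by
  unfold bridge
  split_ifs with h
  · rfl
  · obtain ⟨hx0, hx1⟩ := hx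
    obtain ⟨ht0, ht1⟩ := ht
    simp only [Set.mem_Ioo] at h
    rcases hx0.eq_or_lt with rfl | hx0
    · simp [ht0]
    rcases ht0.eq_or_lt with rfl | ht0
    · simp [hx0.le]
    rcases hx1.eq_or_lt with rfl | hx1
    · simp [ht1]
    rcases ht1.eq_or_lt with rfl | ht1
    · simp [hx1.le]
    exact absurd ⟨⟨hx0, hx1⟩, ht0, ht1⟩ h

lemma bridge_nonneg (x t : ℝ) : 0 ≤ bridge x t := by
  unfold bridge
  split_ifs with h
  · obtain ⟨⟨h1, h2⟩, h3, h4⟩ := h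
    rcases le_total x t with h | h
    · rw [min_eq_left h]; nlinarith
    · rw [min_eq_right h]; nlinarith
  · exact le_rfl

lemma bridge_le (x t : ℝ) : bridge x t ≤ if x ∈ Set.Ioo (0 : ℝ) 1 then 1 else 0 := by
  unfold bridge
  split_ifs with h h' h'
  · obtain ⟨⟨h1, h2⟩, h3, h4⟩ := h
    rcases le_total x t with h | h
    · rw [min_eq_left h]; nlinarith [sq_nonneg (2 * x - 1)]
    · rw [min_eq_right h]; nlinarith [sq_nonneg (2 * t - 1)]
  · exact absurd h.1 h'
  · exact zero_le_one
  · exact le_rfl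

lemma bridge_of_notMem_left {x t : ℝ} (h : x ∉ Set.Ioo (0 : ℝ) 1) : bridge x t = 0 :=
  if_neg fun h' => h h'.1

lemma bridge_of_notMem_right {x t : ℝ} (h : t ∉ Set.Ioo (0 : ℝ) 1) : bridge x t = 0 :=
  if_neg fun h' => h h'.2

lemma hat_of_notMem {s : ℝ} (h : s ∉ Set.Ioo (0 : ℝ) 1) : hat s = 0 :=
  le_antisymm ((hat_le s).trans_eq (if_neg h)) (hat_nonneg s)

lemma hat_of_le {s : ℝ} (h0 : 0 ≤ s) (h : s ≤ 1 / 2) : hat s = 2 * s := by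
  rw [hat, abs_of_nonpos (by linarith), max_eq_right (by linarith)]; ring

lemma hat_of_ge {s : ℝ} (h0 : s ≤ 1) (h : 1 / 2 ≤ s) : hat s = 2 * (1 - s) := by
  rw [hat, abs_of_nonneg (by linarith), max_eq_right (by linarith)]; ring

/-- In `t`, `bridge x` is piecewise linear with its only interior kink at `x`, and its value at
`1/2` is `hat x / 2`. Subtracting the interpolation at the midpoint leaves a half-size copy on the
half containing `x` and zero on the other half. Extension by zero makes this valid for all reals. -/
lemma bridge_self_similar (x t : ℝ) :
    bridge x t = hat x * hat t / 2 +
      (bridge (2 * x) (2 * t) + bridge (2 * x - 1) (2 * t - 1)) / 2 := by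
  by_cases hx : x ∈ Set.Ioo (0 : ℝ) 1
  swap
  · have h1 : 2 * x ∉ Set.Ioo (0 : ℝ) 1 := fun h => hx ⟨by linarith [h.1], by linarith [h.1, h.2]⟩
    have h2 : 2 * x - 1 ∉ Set.Ioo (0 : ℝ) 1 := fun h => hx ⟨by linarith [h.1], by linarith [h.2]⟩
    simp [bridge_of_notMem_left hx, bridge_of_notMem_left h1, bridge_of_notMem_left h2,
      hat_of_notMem hx]
  by_cases ht : t ∈ Set.Ioo (0 : ℝ) 1
  swap
  · have h1 : 2 * t ∉ Set.Ioo (0 : ℝ) 1 := fun h => ht ⟨by linarith [h.1], by linarith [h.1, h.2]⟩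
    have h2 : 2 * t - 1 ∉ Set.Ioo (0 : ℝ) 1 := fun h => ht ⟨by linarith [h.1], by linarith [h.2]⟩
    simp [bridge_of_notMem_right ht, bridge_of_notMem_right h1, bridge_of_notMem_right h2,
      hat_of_notMem ht]
  rw [bridge_eq (Set.Ioo_subset_Icc_self hx) (Set.Ioo_subset_Icc_self ht)]
  obtain ⟨hx0, hx1⟩ := hx
  obtain ⟨ht0, ht1⟩ := ht
  have out_left : ∀ {s : ℝ}, s ≤ 1 / 2 → 2 * s - 1 ∉ Set.Ioo (0 : ℝ) 1 :=
    fun hs h => by linarith [h.1]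
  have out_right : ∀ {s : ℝ}, 1 / 2 ≤ s → 2 * s ∉ Set.Ioo (0 : ℝ) 1 :=
    fun hs h => by linarith [h.2]
  rcases le_total x (1 / 2) with hx | hx <;> rcases le_total t (1 / 2) with ht | ht
  · rw [hat_of_le hx0.le hx, hat_of_le ht0.le ht, bridge_of_notMem_left (out_left hx),
      bridge_eq ⟨by linarith, by linarith⟩ ⟨by linarith, by linarith⟩,
      ← mul_min_of_nonneg x t zero_le_two]
    ring
  · rw [hat_of_le hx0.le hx, hat_of_ge ht1.le ht, bridge_of_notMem_left (out_left hx),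
      bridge_of_notMem_right (out_right ht), min_eq_left (hx.trans ht)]
    ring
  · rw [hat_of_ge hx1.le hx, hat_of_le ht0.le ht, bridge_of_notMem_left (out_right hx),
      bridge_of_notMem_right (out_left ht), min_eq_right (ht.trans hx)]
    ring
  · rw [hat_of_ge hx1.le hx, hat_of_ge ht1.le ht, bridge_of_notMem_left (out_right hx),
      bridge_eq ⟨by linarith, by linarith⟩ ⟨by linarith, by linarith⟩,
      min_sub_sub_right, ← mul_min_of_nonneg x t zero_le_two]
    ring

lemma sum_range_two_mul {M : Type*} [AddCommMonoid M] (g : ℕ → M) (n : ℕ) :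
    ∑ k ∈ Finset.range (2 * n), g k = ∑ k ∈ Finset.range n, (g (2 * k) + g (2 * k + 1)) := by
  induction n with
  | zero => simp
  | succ n ih =>
    rw [mul_add, mul_one, Finset.sum_range_succ, Finset.sum_range_succ, ih,
      Finset.sum_range_succ, add_assoc]

/-- The expansion of `bridge` in products of dilated hat functions, up to level `h`. -/
lemma bridge_expansion (x t : ℝ) (h : ℕ) :
    bridge x t =
      ∑ j ∈ Finset.range h, ∑ k ∈ Finset.range (2 ^ j),
        (1 / 2) ^ j * (hat (2 ^ j * x - k) * hat (2 ^ j * t - k) / 2) +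
      (1 / 2) ^ h * ∑ k ∈ Finset.range (2 ^ h), bridge (2 ^ h * x - k) (2 ^ h * t - k) := by
  induction h with
  | zero => simp
  | succ h ih =>
    rw [ih, Finset.sum_range_succ, add_assoc]
    congr 1
    -- The remainder at level `h + 1` is paired into the children `2k` and `2k + 1` of interval `k`,
    -- so self-similarity applies term by term.
    rw [← Finset.mul_sum, pow_succ' 2 h, sum_range_two_mul, pow_succ (1 / 2 : ℝ), mul_assoc,
      ← mul_add]
    congr 1
    rw [Finset.mul_sum, ← Finset.sum_add_distrib]
    refine Finset.sum_congr rfl fun k _ => ?_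
    rw [bridge_self_similar (2 ^ h * x - k)]
    push_cast
    rw [pow_succ' (2 : ℝ) h]
    ring_nf

/-- Only `k = ⌊s⌋` can satisfy `s - k ∈ (0, 1)`. -/
lemma sum_le_of_localized {g : ℕ → ℝ} {s : ℝ} (N : ℕ)
    (hg : ∀ k, g k ≤ if s - k ∈ Set.Ioo (0 : ℝ) 1 then 1 else 0) :
    ∑ k ∈ Finset.range N, g k ≤ 1 := by
  have h : ∀ k ∈ Finset.range N, g k ≤ if ⌊s⌋₊ = k then (1 : ℝ) else 0 := by
    intro k _
    refine (hg k).trans ?_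
    split_ifs with h1 h2 h2
    · exact le_rfl
    · refine absurd ((Nat.floor_eq_iff ?_).2 ⟨by linarith [h1.1], by linarith [h1.2]⟩) h2
      have : (0 : ℝ) ≤ k := k.cast_nonneg
      linarith [h1.1]
    · exact zero_le_one
    · exact le_rfl
  refine (Finset.sum_le_sum h).trans ?_
  rw [Finset.sum_ite_eq]
  split_ifs <;> simp

lemma sum_hat_le (s : ℝ) (N : ℕ) : ∑ k ∈ Finset.range N, hat (s - k) ≤ 1 :=
  sum_le_of_localized N fun _ => hat_le _

/-- The index set of the coefficients: the root, and the dyadic intervals of length more than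
`2 ^ (-h)`. -/
abbrev DyadicIndex (h : ℕ) : Type := Option (Σ j : Fin h, Fin (2 ^ (j : ℕ)))

/-- The coefficients of the distance from `x`. -/
noncomputable def distCoeff (h : ℕ) (x : ℝ) : DyadicIndex h → ℝ
  | none => x
  | some ⟨j, k⟩ => (1 / 2) ^ (j : ℕ) * (hat (2 ^ (j : ℕ) * x - (k : ℕ)) / 2)

/-- The basis functions. -/
noncomputable def distBasis (h : ℕ) (t : ℝ) : DyadicIndex h → ℝ
  | none => 1 - 2 * t
  | some ⟨j, k⟩ => -hat (2 ^ (j : ℕ) * t - (k : ℕ))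

lemma sum_dyadic {M : Type*} [AddCommMonoid M] {h : ℕ} (g : DyadicIndex h → M) :
    ∑ i, g i = g none + ∑ j : Fin h, ∑ k : Fin (2 ^ (j : ℕ)), g (some ⟨j, k⟩) := by
  rw [Fintype.sum_option, Fintype.sum_sigma]

/-- The summand `t` comes from the query and needs no noise. The truncation error is `2 ^ (-h)`
times a sum of localized terms in `[0, 1]`, at most one of them nonzero. -/
lemma abs_distCoeff_sub_dist_le (h : ℕ) {x t : ℝ} (hx : x ∈ Set.Icc (0 : ℝ) 1)
    (ht : t ∈ Set.Icc (0 : ℝ) 1) :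
    |t + (∑ i, distCoeff h x i * distBasis h t i) - (|x - t|)| ≤ (1 / 2) ^ h := by
  have h1 := bridge_expansion x t h
  have h2 : |x - t| = t + x * (1 - 2 * t) - bridge x t := by
    rw [bridge_eq hx ht]
    rcases le_total x t with h | h
    · rw [min_eq_left h, abs_of_nonpos (by linarith)]; ring
    · rw [min_eq_right h, abs_of_nonneg (by linarith)]; ring
  have h3 : ∑ i, distCoeff h x i * distBasis h t i = x * (1 - 2 * t) -
      ∑ j ∈ Finset.range h, ∑ k ∈ Finset.range (2 ^ j),
        (1 / 2) ^ j * (hat (2 ^ j * x - k) * hat (2 ^ j * t - k) / 2) := by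
    rw [sum_dyadic, sub_eq_add_neg, ← Finset.sum_neg_distrib]
    congr 1
    rw [← Fin.sum_univ_eq_sum_range (fun j => -∑ k ∈ Finset.range (2 ^ j),
        (1 / 2 : ℝ) ^ j * (hat (2 ^ j * x - k) * hat (2 ^ j * t - k) / 2))]
    refine Finset.sum_congr rfl fun j _ => ?_
    rw [← Finset.sum_neg_distrib, ← Fin.sum_univ_eq_sum_range (fun k : ℕ =>
        -((1 / 2 : ℝ) ^ (j : ℕ) * (hat (2 ^ (j : ℕ) * x - k) * hat (2 ^ (j : ℕ) * t - k) / 2)))]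
    refine Finset.sum_congr rfl fun k _ => ?_
    simp only [distCoeff, distBasis]
    ring
  have h4 : 0 ≤ ∑ k ∈ Finset.range (2 ^ h), bridge (2 ^ h * x - k) (2 ^ h * t - k) :=
    Finset.sum_nonneg fun _ _ => bridge_nonneg _ _
  have h5 : ∑ k ∈ Finset.range (2 ^ h), bridge (2 ^ h * x - k) (2 ^ h * t - k) ≤ 1 :=
    sum_le_of_localized _ fun _ => bridge_le _ _
  have h6 : t + (∑ i, distCoeff h x i * distBasis h t i) - |x - t| =
      (1 / 2) ^ h * ∑ k ∈ Finset.range (2 ^ h), bridge (2 ^ h * x - k) (2 ^ h * t - k) := by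
    rw [h3, h2, h1]; ring
  rw [h6, abs_of_nonneg (by positivity)]
  exact mul_le_of_le_one_right (by positivity) h5

/-! ### Weighted sensitivity and noise thresholds -/

lemma geom_sum_le_inv {r : ℝ} (h0 : 0 ≤ r) (h1 : r < 1) (n : ℕ) :
    ∑ j ∈ Finset.range n, r ^ j ≤ (1 - r)⁻¹ := by
  rw [← tsum_geometric_of_lt_one h0 h1]
  exact (summable_geometric_of_lt_one h0 h1).sum_le_tsum _ fun _ _ => pow_nonneg h0 _

/-- The relative noise scales. -/
noncomputable def dyadicScale (h : ℕ) : DyadicIndex h → ℝ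
  | none => 1
  | some ⟨j, _⟩ => (3 / 4) ^ (j : ℕ)

lemma dyadicScale_pos (h : ℕ) (i : DyadicIndex h) : 0 < dyadicScale h i := by
  rcases i with _ | ⟨j, k⟩ <;> simp only [dyadicScale] <;> positivity

lemma distCoeff_nonneg (h : ℕ) {x : ℝ} (hx : 0 ≤ x) (i : DyadicIndex h) : 0 ≤ distCoeff h x i := by
  rcases i with _ | ⟨j, k⟩
  · exact hx
  · have := hat_nonneg (2 ^ (j : ℕ) * x - (k : ℕ))
    simp only [distCoeff]
    positivity

/-- The hats of a level sum to at most `1`, so level `j` contributes at most `(1/2) ^ j / 2` divided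
by `(3/4) ^ j`. Any ratio strictly between `1/2` and `1` would make both this sum and the noise sum
converge. The root gives `1` and the levels `3/2`. -/
lemma sum_distCoeff_div_scale_le (h : ℕ) {x : ℝ} (hx : x ≤ 1) :
    ∑ i, distCoeff h x i / dyadicScale h i ≤ 5 / 2 := by
  rw [sum_dyadic]
  have h1 : ∀ j : Fin h, ∑ k : Fin (2 ^ (j : ℕ)),
      distCoeff h x (some ⟨j, k⟩) / dyadicScale h (some ⟨j, k⟩) ≤ (2 / 3) ^ (j : ℕ) / 2 := by
    intro j
    have h2 := sum_hat_le (2 ^ (j : ℕ) * x) (2 ^ (j : ℕ))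
    rw [← Fin.sum_univ_eq_sum_range (fun k : ℕ => hat (2 ^ (j : ℕ) * x - k))] at h2
    calc _ = (2 / 3) ^ (j : ℕ) / 2 * ∑ k : Fin (2 ^ (j : ℕ)), hat (2 ^ (j : ℕ) * x - (k : ℕ)) := by
          rw [Finset.mul_sum]
          refine Finset.sum_congr rfl fun k _ => ?_
          simp only [distCoeff, dyadicScale]
          rw [show (2 / 3 : ℝ) = 1 / 2 / (3 / 4) by norm_num, div_pow (1 / 2 : ℝ)]
          ring
      _ ≤ _ := mul_le_of_le_one_right (by positivity) h2
  have h3 : ∑ j : Fin h, (2 / 3 : ℝ) ^ (j : ℕ) / 2 ≤ 3 / 2 := by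
    rw [Fin.sum_univ_eq_sum_range (fun j => (2 / 3 : ℝ) ^ j / 2), ← Finset.sum_div]
    have := geom_sum_le_inv (r := 2 / 3) (by norm_num) (by norm_num) h
    norm_num at this ⊢
    linarith
  have h4 := Finset.sum_le_sum fun j (_ : j ∈ Finset.univ) => h1 j
  simp only [distCoeff, dyadicScale] at h4 ⊢
  linarith

lemma sum_abs_distCoeff_sub_le (h : ℕ) {x y : ℝ} (hx : x ∈ Set.Icc (0 : ℝ) 1)
    (hy : y ∈ Set.Icc (0 : ℝ) 1) :
    ∑ i, |distCoeff h x i - distCoeff h y i| / dyadicScale h i ≤ 5 := by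
  have h1 : ∀ i, |distCoeff h x i - distCoeff h y i| / dyadicScale h i ≤
      distCoeff h x i / dyadicScale h i + distCoeff h y i / dyadicScale h i := fun i => by
    rw [← add_div]
    refine div_le_div_of_nonneg_right ?_ (dyadicScale_pos h i).le
    have h2 := distCoeff_nonneg h hx.1 i
    have h3 := distCoeff_nonneg h hy.1 i
    exact abs_sub_le_iff.2 ⟨by linarith, by linarith⟩
  refine (Finset.sum_le_sum fun i _ => h1 i).trans ?_
  rw [Finset.sum_add_distrib]
  linarith [sum_distCoeff_div_scale_le h hx.2, sum_distCoeff_div_scale_le h hy.2]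

/-- Extra logarithmic terms in the tail bounds, which make the failure probabilities summable. -/
noncomputable def dyadicTail (h : ℕ) : DyadicIndex h → ℝ
  | none => Real.log 2
  | some ⟨j, _⟩ => (j + 1 : ℕ) * Real.log 4

lemma dyadicTail_nonneg (h : ℕ) (i : DyadicIndex h) : 0 ≤ dyadicTail h i := by
  rcases i with _ | ⟨j, k⟩ <;> simp only [dyadicTail] <;> positivity

/-- Level `j` has `2 ^ j` indices of weight `4 ^ (-(j + 1))`, so the levels total at most `1/2`; the
root supplies the other `1/2`. -/
lemma sum_exp_neg_dyadicTail_le (h : ℕ) : ∑ i, Real.exp (-dyadicTail h i) ≤ 1 := by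
  rw [sum_dyadic]
  have h1 : ∀ j : Fin h, ∑ k : Fin (2 ^ (j : ℕ)), Real.exp (-dyadicTail h (some ⟨j, k⟩)) =
      (1 / 2) ^ (j : ℕ) / 4 := by
    intro j
    simp only [dyadicTail, Finset.sum_const, Finset.card_univ, Fintype.card_fin, nsmul_eq_mul]
    rw [Real.exp_neg, Real.exp_nat_mul, Real.exp_log (by norm_num), pow_succ]
    rw [show (4 : ℝ) ^ (j : ℕ) = 2 ^ (j : ℕ) * 2 ^ (j : ℕ) by rw [← mul_pow]; norm_num]
    push_cast
    rw [one_div, inv_pow]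
    field_simp
  rw [Finset.sum_congr rfl fun j _ => h1 j, Fin.sum_univ_eq_sum_range (fun j => (1 / 2 : ℝ) ^ j / 4),
    ← Finset.sum_div]
  simp only [dyadicTail, Real.exp_neg]
  rw [Real.exp_log (by norm_num)]
  have := geom_sum_le_inv (r := 1 / 2) (by norm_num) (by norm_num) h
  norm_num at this ⊢
  linarith

/-- The right side is the exact value of the sum, which lets the induction close; its limit is `16 =
(1 - 3/4) ^ (-2)`. -/
lemma sum_geom_mul_succ_le (h : ℕ) :
    ∑ j ∈ Finset.range h, (3 / 4 : ℝ) ^ j * (j + 1) ≤ 16 - (3 / 4) ^ h * (4 * h + 16) := by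
  induction h with
  | zero => simp
  | succ h ih =>
    rw [Finset.sum_range_succ, pow_succ]
    push_cast
    linarith

/-- Noise below the tail thresholds changes the answer only by a constant number of units. -/
lemma abs_sum_noise_le (h : ℕ) {t s lam : ℝ} (ht : t ∈ Set.Icc (0 : ℝ) 1) (hs : 0 ≤ s)
    (hlam : 0 ≤ lam) {ω : DyadicIndex h → ℝ}
    (hω : ∀ i, |ω i| ≤ s * dyadicScale h i * (lam + dyadicTail h i)) :
    |∑ i, ω i * distBasis h t i| ≤ s * (5 * lam + 24) := by
  have hlog2 : Real.log 2 ≤ 0.7 := by linarith [Real.log_two_lt_d9]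
  have hlog4 : Real.log 4 = 2 * Real.log 2 := by
    rw [show (4 : ℝ) = 2 ^ 2 by norm_num, Real.log_pow]; norm_num
  have h0 : ∀ i, |ω i * distBasis h t i| ≤
      s * dyadicScale h i * (lam + dyadicTail h i) * |distBasis h t i| := fun i => by
    rw [abs_mul]
    exact mul_le_mul_of_nonneg_right (hω i) (abs_nonneg _)
  refine (Finset.abs_sum_le_sum_abs _ _).trans ((Finset.sum_le_sum fun i _ => h0 i).trans ?_)
  rw [sum_dyadic]
  have hroot : s * dyadicScale h none * (lam + dyadicTail h none) * |distBasis h t none| ≤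
      s * (lam + 0.7) := by
    simp only [dyadicScale, dyadicTail, distBasis, mul_one]
    have h1 : |1 - 2 * t| ≤ 1 := abs_le.2 ⟨by linarith [ht.2], by linarith [ht.1]⟩
    have h2 : 0 ≤ s * (lam + Real.log 2) := by positivity
    refine (mul_le_of_le_one_right h2 h1).trans ?_
    gcongr
  -- Scale and threshold are constant on a level and the hats sum to at most `1`, so the whole level
  -- costs a single threshold; `1.4` bounds `log 4`.
  have hlevel : ∀ j : Fin h, ∑ k : Fin (2 ^ (j : ℕ)), s * dyadicScale h (some ⟨j, k⟩) *
      (lam + dyadicTail h (some ⟨j, k⟩)) * |distBasis h t (some ⟨j, k⟩)| ≤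
      s * ((3 / 4) ^ (j : ℕ) * lam + (3 / 4) ^ (j : ℕ) * ((j : ℕ) + 1) * 1.4) := by
    intro j
    have h2 := sum_hat_le (2 ^ (j : ℕ) * t) (2 ^ (j : ℕ))
    rw [← Fin.sum_univ_eq_sum_range (fun k : ℕ => hat (2 ^ (j : ℕ) * t - k))] at h2
    simp only [dyadicScale, dyadicTail, distBasis, abs_neg, abs_of_nonneg (hat_nonneg _)]
    rw [← Finset.mul_sum]
    refine (mul_le_of_le_one_right (by positivity) h2).trans ?_
    rw [mul_assoc, mul_add ((3 / 4 : ℝ) ^ (j : ℕ)), mul_assoc ((3 / 4 : ℝ) ^ (j : ℕ)) ((j : ℕ) + 1 : ℝ)]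
    push_cast
    gcongr
    linarith
  have hsum : ∑ j : Fin h, s * ((3 / 4 : ℝ) ^ (j : ℕ) * lam +
      (3 / 4) ^ (j : ℕ) * ((j : ℕ) + 1) * 1.4) ≤ s * (4 * lam + 16 * 1.4) := by
    rw [← Finset.mul_sum, Finset.sum_add_distrib, ← Finset.sum_mul, ← Finset.sum_mul,
      Fin.sum_univ_eq_sum_range (fun j => (3 / 4 : ℝ) ^ j),
      Fin.sum_univ_eq_sum_range (fun j => (3 / 4 : ℝ) ^ j * ((j : ℝ) + 1))]
    have h1 := sum_geom_mul_succ_le h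
    have h2 : ∑ j ∈ Finset.range h, (3 / 4 : ℝ) ^ j ≤ 4 := by
      have := geom_sum_le_inv (r := 3 / 4) (by norm_num) (by norm_num) h
      norm_num at this ⊢
      exact this
    have h3 : (0 : ℝ) ≤ (3 / 4) ^ h * (4 * h + 16) := by positivity
    refine mul_le_mul_of_nonneg_left (add_le_add ?_ ?_) hs
    · exact mul_le_mul_of_nonneg_right (by linarith) hlam
    · exact mul_le_mul_of_nonneg_right (by linarith) (by norm_num)
  -- Root and levels together: `1 + 4 = 5` for `lam`, and `0.7 + 16 * 1.4 ≤ 24`.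
  have := Finset.sum_le_sum fun j (_ : j ∈ Finset.univ) => hlevel j
  nlinarith

/-! ### Accuracy via embeddings -/

section
variable {X Y : Type*} [MetricSpace X] [MetricSpace Y] {π : X → Y} {Q : Set X}

lemma dist_le_of_expansion (h : expansion π Q ≤ 1) (x : X) {y : X} (hy : y ∈ Q) :
    dist (π x) (π y) ≤ dist x y := by
  have h1 : edist (π x) (π y) / edist x y ≤ 1 :=
    (le_iSup₂_of_le (f := fun x y => ⨆ _ : y ∈ Q, edist (π x) (π y) / edist x y) x y
      (le_iSup_of_le hy le_rfl)).trans h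
  rw [edist_dist, edist_dist] at h1
  rcases (dist_nonneg (x := x) (y := y)).eq_or_lt with h0 | h0
  · have : x = y := dist_eq_zero.1 h0.symm
    simp [this]
  · rw [← ENNReal.ofReal_div_of_pos h0, ENNReal.ofReal_le_one, div_le_one h0] at h1
    exact h1

lemma dist_le_of_contraction {C : ℝ} (h : contraction π Q ≤ ENNReal.ofReal C) (x : X) {y : X}
    (hy : y ∈ Q) : 1 / C * dist x y ≤ dist (π x) (π y) := by
  have h1 : edist x y / edist (π x) (π y) ≤ ENNReal.ofReal C :=
    (le_iSup₂_of_le (f := fun x y => ⨆ _ : y ∈ Q, edist x y / edist (π x) (π y)) x y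
      (le_iSup_of_le hy le_rfl)).trans h
  rw [edist_dist, edist_dist] at h1
  -- The sign of `C` is not assumed; for `C ≤ 0` the left side is nonpositive, with `1 / 0 = 0`.
  rcases le_or_gt C 0 with hC | hC
  · exact (mul_nonpos_of_nonpos_of_nonneg (by simpa using hC) dist_nonneg).trans dist_nonneg
  rcases (dist_nonneg (x := π x) (y := π y)).eq_or_lt with h0 | h0
  · rw [← h0] at h1 ⊢
    rcases (dist_nonneg (x := x) (y := y)).eq_or_lt with h2 | h2
    · rw [← h2, mul_zero]
    -- Distinct points with equal images would make the contraction infinite.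
    · rw [ENNReal.ofReal_zero, ENNReal.div_zero (by simpa using h2), top_le_iff] at h1
      exact absurd h1 ENNReal.ofReal_ne_top
  · rw [← ENNReal.ofReal_div_of_pos h0, ENNReal.ofReal_le_ofReal_iff hC.le, div_le_iff₀ h0] at h1
    rw [one_div_mul_eq_div, div_le_iff₀' hC]
    exact h1

lemma avgDist_comp_le {n : ℕ} (h : expansion π Q ≤ 1) (D : Fin n → X) {y : X} (hy : y ∈ Q) :
    avgDist (π ∘ D) (π y) ≤ avgDist D y :=
  mul_le_mul_of_nonneg_left (Finset.sum_le_sum fun i _ => dist_le_of_expansion h (D i) hy)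
    (by positivity)

lemma le_avgDist_comp {n : ℕ} {C : ℝ} (h : contraction π Q ≤ ENNReal.ofReal C) (D : Fin n → X)
    {y : X} (hy : y ∈ Q) : 1 / C * avgDist D y ≤ avgDist (π ∘ D) (π y) := by
  unfold avgDist
  rw [mul_left_comm, Finset.mul_sum]
  exact mul_le_mul_of_nonneg_left (Finset.sum_le_sum fun i _ => dist_le_of_contraction h (D i) hy)
    (by positivity)

end

lemma HoldsExceptWithProb.mono {Ω : Type*} [MeasurableSpace Ω] {μ : Measure Ω} {p q : Ω → Prop}
    {β : ℝ} (h : HoldsExceptWithProb μ p β) (hpq : ∀ ω, p ω → q ω) : HoldsExceptWithProb μ q β :=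
  (measure_mono fun ω (hω : ¬ q ω) hp => hω (hpq ω hp)).trans h

lemma InteractiveMechanism.IsAccurate.viaEmbeddings {n k : ℕ} {Y : Type v} [MetricSpace Y]
    {M : InteractiveMechanism n Y} {α β : ℝ} (h : M.IsAccurate k α β) :
    InteractiveMechanism.IsAccurateViaEmbeddings.{u} M k α β := by
  intro X _ hX D Q π C hexp hcon
  refine HoldsExceptWithProb.mono (h (π ∘ D) (π ∘ Q) fun i j =>
    (dist_le_of_expansion hexp _ ⟨j, rfl⟩).trans (hX _ _)) fun ω hω j => ?_
  have h1 := abs_le.1 (hω j)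
  have h2 := avgDist_comp_le hexp D (Set.mem_range_self j)
  have h3 := le_avgDist_comp hcon D (Set.mem_range_self j)
  have h4 : (M.viaEmbedding π).run D Q j ω = M.run (π ∘ D) (π ∘ Q) j ω := rfl
  rw [h4]
  simp only [Function.comp_apply (f := π) (g := Q)] at h1
  exact ⟨by linarith [h1.1], by linarith [h1.2]⟩

lemma OfflineMechanism.IsAccurate.viaEmbeddings {n : ℕ} {Y : Type v} [MetricSpace Y]
    {M : OfflineMechanism n Y} {α β : ℝ} (h : M.IsAccurate α β) :
    OfflineMechanism.IsAccurateViaEmbeddings.{u} M α β := by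
  intro X _ hX D Q π C hexp hcon
  refine HoldsExceptWithProb.mono (h (π ∘ D) (π '' Q) ?_) fun z hz y hy => ?_
  · rintro i _ ⟨y, hy, rfl⟩
    exact (dist_le_of_expansion hexp _ hy).trans (hX _ _)
  have h1 := abs_le.1 (hz (π y) ⟨y, hy, rfl⟩)
  have h2 := avgDist_comp_le hexp D hy
  have h3 := le_avgDist_comp hcon D hy
  have h4 : (M.viaEmbedding π).eval z y = M.eval z (π y) := rfl
  rw [h4]
  exact ⟨by linarith [h1.1], by linarith [h1.2]⟩

lemma InteractiveMechanism.IsAccurate.mono {n k : ℕ} {X : Type*} [MetricSpace X]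
    {M : InteractiveMechanism n X} {α α' β : ℝ} (h : M.IsAccurate k α β) (hα : α ≤ α') :
    M.IsAccurate k α' β := fun D Q hQ =>
  (h D Q hQ).mono fun _ hω j => (hω j).trans hα

lemma OfflineMechanism.IsAccurate.mono {n : ℕ} {X : Type*} [MetricSpace X]
    {M : OfflineMechanism n X} {α α' β : ℝ} (h : M.IsAccurate α β) (hα : α ≤ α') :
    M.IsAccurate α' β := fun D Q hQ =>
  (h D Q hQ).mono fun _ hω y hy => (hω y hy).trans hα

/-! ### Mechanisms that add Laplace noise to a synopsis -/

lemma measurable_snoc {Ω Z : Type*} [MeasurableSpace Ω] [MeasurableSpace Z] {j : ℕ}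
    {g : Ω → Fin j → Z} {a : Ω → Z} (hg : Measurable g) (ha : Measurable a) :
    Measurable fun ω => Fin.snoc (α := fun _ => Z) (g ω) (a ω) := by
  refine measurable_pi_iff.2 fun i => ?_
  induction i using Fin.lastCases with
  | cast i =>
    rw [funext fun ω => Fin.snoc_castSucc (α := fun _ => Z) (a ω) (g ω) i]
    exact (measurable_pi_apply i).comp hg
  | last =>
    rw [funext fun ω => Fin.snoc_last (α := fun _ => Z) (a ω) (g ω)]
    exact ha

/-- The adaptively chosen queries are themselves random, hence the need for joint measurability of
the answers. -/
lemma InteractiveMechanism.IsMeasurable.transcript {n : ℕ} {X : Type*} [MeasurableSpace X]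
    {M : InteractiveMechanism n X} (hM : M.IsMeasurable) (D : Fin n → X)
    {analyst : (j : ℕ) → (Fin j → ℝ) → X} (ha : ∀ j, Measurable (analyst j)) (j : ℕ) :
    Measurable fun ω => M.transcript D analyst ω j := by
  induction j with
  | zero => exact measurable_pi_iff.2 fun i => i.elim0
  | succ j ih =>
    have ih' := measurable_pi_iff.1 ih
    have hq : Measurable fun ω => analyst j fun i => (M.transcript D analyst ω j i).2 :=
      (ha j).comp (measurable_pi_iff.2 fun i => (ih' i).snd)
    exact measurable_snoc ih (hq.prodMk ((hM D j).comp (Measurable.prodMk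
      (measurable_snoc (measurable_pi_iff.2 fun i => (ih' i).fst) hq) measurable_id)))

section
variable {n : ℕ} {X : Type*} {ι : Type} [Fintype ι] {b : ι → ℝ}

/-- Release the statistic `f D` with Laplace noise and answer all queries by means of `eval`. -/
noncomputable def laplaceOffline [MeasurableSpace X] (hb : ∀ i, 0 < b i)
    (f : (Fin n → X) → ι → ℝ)
    {eval : (ι → ℝ) → X → ℝ} (he : Measurable fun p : (ι → ℝ) × X => eval p.1 p.2) :
    OfflineMechanism n X where
  Synopsis := ι → ℝ
  release D := (laplacePi b).map fun ω => f D + ω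
  isProb D :=
    have := isProbabilityMeasure_laplacePi hb
    Measure.isProbabilityMeasure_map (measurable_const_add (f D)).aemeasurable
  eval := eval
  measurable_eval _ := he.comp (measurable_id.prodMk measurable_const)

/-- The interactive form of `laplaceOffline`. -/
noncomputable def laplaceInteractive [MeasurableSpace X] (hb : ∀ i, 0 < b i)
    (f : (Fin n → X) → ι → ℝ)
    {eval : (ι → ℝ) → X → ℝ} (he : Measurable fun p : (ι → ℝ) × X => eval p.1 p.2) :
    InteractiveMechanism n X where
  Ω := ι → ℝ
  P := laplacePi b
  isProb := isProbabilityMeasure_laplacePi hb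
  answer D j q ω := eval (f D + ω) (q (Fin.last j))
  measurable_answer D _ _ := he.comp ((measurable_const_add (f D)).prodMk measurable_const)

variable [MeasurableSpace X] (hb : ∀ i, 0 < b i) (f : (Fin n → X) → ι → ℝ)
    {eval : (ι → ℝ) → X → ℝ} (he : Measurable fun p : (ι → ℝ) × X => eval p.1 p.2)

lemma isMeasurable_laplaceOffline : (laplaceOffline hb f he).IsMeasurable := he

lemma isMeasurable_laplaceInteractive : (laplaceInteractive hb f he).IsMeasurable := fun D _ =>
  he.comp (((measurable_const_add (f D)).comp measurable_snd).prodMk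
    ((measurable_pi_apply _).comp measurable_fst))

variable {f}

lemma isDifferentiallyPrivate_laplaceOffline {ε : ℝ}
    (hf : ∀ D₁ D₂ : Fin n → X, Adjacent D₁ D₂ → ∑ i, |f D₁ i - f D₂ i| / b i ≤ ε) :
    (laplaceOffline hb f he).IsDifferentiallyPrivate ε 0 :=
  fun D₁ D₂ h => indistinguishable_laplacePi hb (hf D₁ D₂ h)

/-- The data enter only through `f D + ω`. Moving `f D` into the noise exhibits the whole adaptive
transcript as postprocessing of the noisy statistic. -/
lemma transcript_laplaceInteractive (D : Fin n → X) (analyst : (j : ℕ) → (Fin j → ℝ) → X)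
    (ω : ι → ℝ) (j : ℕ) :
    (laplaceInteractive hb f he).transcript D analyst ω j =
      (laplaceInteractive hb (fun _ : Fin n → X => (0 : ι → ℝ)) he).transcript D analyst
        (f D + ω) j := by
  induction j with
  | zero => rfl
  | succ j ih =>
    simp only [InteractiveMechanism.transcript, ih]
    simp only [laplaceInteractive, zero_add]

/-- With a constant statistic the database is never consulted, so one postprocessing map serves both
adjacent databases. -/
lemma transcript_laplaceInteractive_const (D D' : Fin n → X) (c : ι → ℝ)
    (analyst : (j : ℕ) → (Fin j → ℝ) → X) (ω : ι → ℝ) (j : ℕ) :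
    (laplaceInteractive hb (fun _ : Fin n → X => c) he).transcript D analyst ω j =
      (laplaceInteractive hb (fun _ : Fin n → X => c) he).transcript D' analyst ω j := by
  induction j with
  | zero => rfl
  | succ j ih =>
    simp only [InteractiveMechanism.transcript, ih]
    simp only [laplaceInteractive]

lemma isDifferentiallyPrivate_laplaceInteractive {ε : ℝ} (k : ℕ)
    (hf : ∀ D₁ D₂ : Fin n → X, Adjacent D₁ D₂ → ∑ i, |f D₁ i - f D₂ i| / b i ≤ ε) :
    (laplaceInteractive hb f he).IsDifferentiallyPrivate k ε 0 := by
  intro analyst ha D₁ D₂ h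
  have hg : Measurable fun ω : ι → ℝ =>
      (laplaceInteractive hb (fun _ : Fin n → X => (0 : ι → ℝ)) he).transcript D₁ analyst ω k :=
    (isMeasurable_laplaceInteractive hb _ he).transcript D₁ ha k
  exact indistinguishable_laplacePi_comp hb (hf D₁ D₂ h) hg
    (fun ω => transcript_laplaceInteractive hb he D₁ analyst ω k)
    fun ω => (transcript_laplaceInteractive hb he D₂ analyst ω k).trans
      (transcript_laplaceInteractive_const hb he _ _ _ _ _ _)

end

/-- The union bound is applied to the noise alone, so `p` need not be measurable and may quantify
over uncountably many queries. -/
lemma holdsExceptWithProb_laplacePi {ι : Type} [Fintype ι] {b : ι → ℝ} (hb : ∀ i, 0 < b i)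
    {β : ℝ} {T : ι → ℝ} (hT : ∀ i, 0 ≤ T i)
    (hβ : ∑ i, Real.exp (-(T i / b i)) ≤ β) {p : (ι → ℝ) → Prop}
    (h : ∀ ω, (∀ i, |ω i| ≤ T i) → p ω) : HoldsExceptWithProb (laplacePi b) p β := by
  refine (measure_mono fun ω hω => ?_).trans
    ((laplacePi_tail hb hT).trans (ENNReal.ofReal_le_ofReal hβ))
  by_contra hω'
  refine hω (h ω fun i => ?_)
  by_contra hi
  exact hω' ⟨i, not_le.1 hi⟩

section
variable {n : ℕ} {X : Type*} {ι : Type} [Fintype ι] {b : ι → ℝ} [MetricSpace X] [MeasurableSpace X]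
  (hb : ∀ i, 0 < b i) {f : (Fin n → X) → ι → ℝ}
  {eval : (ι → ℝ) → X → ℝ} (he : Measurable fun p : (ι → ℝ) × X => eval p.1 p.2) {α β : ℝ}

lemma isAccurate_laplaceOffline
    (h : ∀ D : Fin n → X, HoldsExceptWithProb (laplacePi b) (fun ω => ∀ y, (∀ i, dist (D i) y ≤ 1) →
      |eval (f D + ω) y - avgDist D y| ≤ α) β) :
    (laplaceOffline hb f he).IsAccurate α β := by
  intro D Q hQ
  -- Translation is a measurable equivalence, so the pushforward formula holds even for this
  -- possibly nonmeasurable failure set.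
  have h1 := (MeasurableEquiv.addLeft (f D)).map_apply (μ := laplacePi b)
    {z | ¬ ∀ y ∈ Q, |eval z y - avgDist D y| ≤ α}
  refine h1.le.trans (HoldsExceptWithProb.mono (h D) fun ω hω y hy => ?_)
  exact hω y fun i => hQ i y hy

lemma isAccurate_laplaceInteractive (k : ℕ)
    (h : ∀ D : Fin n → X, HoldsExceptWithProb (laplacePi b) (fun ω => ∀ y, (∀ i, dist (D i) y ≤ 1) →
      |eval (f D + ω) y - avgDist D y| ≤ α) β) :
    (laplaceInteractive hb f he).IsAccurate k α β := by
  intro D Q hQ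
  exact HoldsExceptWithProb.mono (h D) fun ω hω j => hω (Q j) fun i => hQ i j

end

/-! ### Sensitivity of averages -/

lemma sum_le_of_adjacent {n : ℕ} {X : Type*} {D₁ D₂ : Fin n → X} (h : Adjacent D₁ D₂)
    {g : Fin n → ℝ} {B : ℝ} (hB : 0 ≤ B) (h0 : ∀ m, D₁ m = D₂ m → g m = 0) (h1 : ∀ m, g m ≤ B) :
    ∑ m, g m ≤ B := by
  by_cases h3 : ∃ m, D₁ m ≠ D₂ m
  · obtain ⟨m, hm⟩ := h3
    rw [Finset.sum_eq_single m (fun m' _ hm' => h0 m' ?_) (by simp)]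
    · exact h1 m
    · by_contra h4
      exact hm' ((Set.ncard_le_one_iff (Set.toFinite _)).1 h h4 hm)
  · push Not at h3
    rw [Finset.sum_eq_zero fun m _ => h0 m (h3 m)]
    exact hB

lemma sensitivity_average_le {n : ℕ} {X ι : Type*} [Fintype ι] {b : ι → ℝ} (hb : ∀ i, 0 < b i)
    {ε : ℝ} (hε : 0 ≤ ε) (hn : 0 < n) {c : X → ι → ℝ}
    (hc : ∀ x y, ∑ i, |c x i - c y i| / b i ≤ n * ε) {D₁ D₂ : Fin n → X} (h : Adjacent D₁ D₂) :
    ∑ i, |1 / (n : ℝ) * ∑ m, c (D₁ m) i - 1 / (n : ℝ) * ∑ m, c (D₂ m) i| / b i ≤ ε := by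
  have hn' : (0 : ℝ) < n := by exact_mod_cast hn
  calc _ ≤ ∑ i, 1 / (n : ℝ) * ∑ m, |c (D₁ m) i - c (D₂ m) i| / b i := by
        refine Finset.sum_le_sum fun i _ => ?_
        rw [← mul_sub, ← Finset.sum_sub_distrib, abs_mul, abs_of_nonneg (by positivity),
          mul_div_assoc, ← Finset.sum_div]
        refine mul_le_mul_of_nonneg_left ?_ (by positivity)
        exact div_le_div_of_nonneg_right (Finset.abs_sum_le_sum_abs _ _) (hb i).le
    _ = 1 / (n : ℝ) * ∑ m, ∑ i, |c (D₁ m) i - c (D₂ m) i| / b i := by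
        rw [← Finset.mul_sum, Finset.sum_comm]
    _ ≤ 1 / (n : ℝ) * (n * ε) := by
        refine mul_le_mul_of_nonneg_left ?_ (by positivity)
        exact sum_le_of_adjacent h (by positivity) (fun m hm => by simp [hm]) fun m => hc _ _
    _ = ε := by field_simp

/-- Truncation to the unit interval. -/
noncomputable def clamp (x : ℝ) : ℝ := max 0 (min 1 x)

lemma continuous_clamp : Continuous clamp := by unfold clamp; fun_prop

/-- Truncation never moves a value away from a target in `[0, 1]`. The cap at `1` is what later
allows fractional powers of the error. -/
lemma abs_clamp_sub_le {x d α : ℝ} (h0 : 0 ≤ d) (h1 : d ≤ 1) (h : |x - d| ≤ α) :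
    |clamp x - d| ≤ min 1 α := by
  have h2 := abs_le.1 h
  unfold clamp
  rcases le_total 1 x with hx | hx
  · rw [min_eq_left hx, max_eq_right zero_le_one, abs_of_nonneg (by linarith)]
    exact le_min (by linarith) (by linarith [h2.2])
  · rw [min_eq_right hx]
    rcases le_total 0 x with h3 | h3
    · rw [max_eq_right h3]
      exact le_min (abs_le.2 ⟨by linarith, by linarith⟩) h
    · rw [max_eq_left h3, abs_of_nonpos (by linarith)]
      exact le_min (by linarith) (by linarith [h2.1])

lemma avgDist_nonneg {n : ℕ} {X : Type*} [MetricSpace X] (D : Fin n → X) (y : X) :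
    0 ≤ avgDist D y :=
  mul_nonneg (by positivity) (Finset.sum_nonneg fun _ _ => dist_nonneg)

lemma avgDist_le_one {n : ℕ} {X : Type*} [MetricSpace X] {D : Fin n → X} {y : X}
    (h : ∀ i, dist (D i) y ≤ 1) : avgDist D y ≤ 1 := by
  have h1 : ∑ i, dist (D i) y ≤ n := by
    simpa using Finset.sum_le_sum fun i (_ : i ∈ Finset.univ) => h i
  rw [avgDist, one_div_mul_eq_div]
  exact div_le_one_of_le₀ h1 (by positivity)

/-! ### A single query, and a single point of the interval -/

/-- A mechanism that answers every query by the noisy answer to the first query. -/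
noncomputable def laplaceFirstQuery (n : ℕ) (X : Type*) [MetricSpace X] {b : ℝ} (hb : 0 < b) :
    InteractiveMechanism n X where
  Ω := Unit → ℝ
  P := laplacePi fun _ => b
  isProb := isProbabilityMeasure_laplacePi fun _ => hb
  -- Capping distances at `1` gives sensitivity `1 / n` in any metric space and changes nothing for
  -- the queries on which accuracy is required.
  answer D _ q ω := clamp (1 / (n : ℝ) * ∑ m, min 1 (dist (D m) (q 0)) + ω ())
  measurable_answer _ _ _ :=
    continuous_clamp.measurable.comp ((measurable_pi_apply ()).const_add _)

/-- This covers `k = 1`, where the error must vanish as `β → 1` and hence contain no additive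
constant. -/
lemma exists_interactive_single {n : ℕ} {X : Type*} [MetricSpace X] [MeasurableSpace X]
    [OpensMeasurableSpace X] {ε β : ℝ} (hn : 0 < n) (hε : 0 < ε) (hβ : 0 < β) (hβ1 : β < 1) :
    ∃ M : InteractiveMechanism n X, M.IsMeasurable ∧ M.IsDifferentiallyPrivate 1 ε 0 ∧
      M.IsAccurate 1 (min 1 (Real.log (1 / β) / (n * ε))) β := by
  have hn' : (0 : ℝ) < n := by exact_mod_cast hn
  have hb : 0 < 1 / (n * ε) := by positivity
  have hlog : 0 ≤ Real.log (1 / β) := Real.log_nonneg (by rw [le_div_iff₀ hβ]; linarith)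
  refine ⟨laplaceFirstQuery n X hb, ?_, ?_, ?_⟩
  · intro D j
    have h1 : ∀ m, Measurable fun p : (Fin (j + 1) → X) × (Unit → ℝ) => dist (D m) (p.1 0) :=
      fun m => (continuous_const.dist continuous_id).measurable.comp
        ((measurable_pi_apply 0).comp measurable_fst)
    have h2 : Measurable fun p : (Fin (j + 1) → X) × (Unit → ℝ) => p.2 () :=
      (measurable_pi_apply ()).comp measurable_snd
    exact continuous_clamp.measurable.comp (((Finset.measurable_fun_sum _ fun m _ =>
      measurable_const.min (h1 m)).const_mul _).add h2)
  · intro analyst ha D₁ D₂ h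
    -- The first query precedes every answer, so it depends on neither noise nor data.
    let y := analyst 0 fun i => i.elim0
    have hsens := sensitivity_average_le (b := fun _ : Unit => 1 / ((n : ℝ) * ε)) (fun _ => hb)
      hε.le hn (c := fun x _ => min 1 (dist x y)) (fun x x' => ?_) h
    · have hG : Measurable fun z : Unit → ℝ =>
          Fin.snoc (α := fun _ => X × ℝ) (Fin.elim0 : Fin 0 → X × ℝ) (y, clamp (z ())) :=
        measurable_snoc measurable_const (measurable_const.prodMk
          (continuous_clamp.measurable.comp (measurable_pi_apply ())))
      have htr : ∀ (D : Fin n → X) (ω : Unit → ℝ),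
          (laplaceFirstQuery n X hb).transcript D analyst ω 1 =
          Fin.snoc (α := fun _ => X × ℝ) (Fin.elim0 : Fin 0 → X × ℝ)
            (y, clamp (1 / (n : ℝ) * ∑ m, min 1 (dist (D m) y) + ω ())) := fun D ω => by
        have hy : (analyst 0 fun i =>
            ((laplaceFirstQuery n X hb).transcript D analyst ω 0 i).2) = y :=
          congrArg (analyst 0) (funext fun i => i.elim0)
        simp only [InteractiveMechanism.transcript] at hy ⊢
        rw [hy]
        rfl
      exact indistinguishable_laplacePi_comp (fun _ => hb) hsens hG (htr D₁) (htr D₂)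
    · have h0 : ∀ z : X, 0 ≤ min 1 (dist z y) := fun z => le_min zero_le_one dist_nonneg
      have h1 : ∀ z : X, min 1 (dist z y) ≤ 1 := fun z => min_le_left _ _
      simp only [Finset.univ_unique, Finset.sum_singleton, div_div_eq_mul_div, div_one]
      refine mul_le_of_le_one_left (by positivity) (abs_le.2 ⟨?_, ?_⟩)
      · linarith [h0 x, h1 x']
      · linarith [h0 x', h1 x]
  · intro D Q hQ
    refine holdsExceptWithProb_laplacePi (b := fun _ : Unit => 1 / ((n : ℝ) * ε)) (fun _ => hb)
      -- At this threshold the Laplace tail bound equals `β` exactly.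
      (T := fun _ => Real.log (1 / β) / (n * ε)) (fun _ => by positivity) ?_ fun ω hω j => ?_
    · simp only [Finset.univ_unique, Finset.sum_singleton]
      rw [div_div_div_cancel_right₀ (by positivity), div_one, one_div, Real.log_inv, neg_neg,
        Real.exp_log hβ]
    · obtain rfl : j = 0 := Subsingleton.elim _ _
      refine abs_clamp_sub_le (avgDist_nonneg _ _) (avgDist_le_one fun i => hQ i 0) ?_
      have h1 : ∀ m, min 1 (dist (D m) (Q 0)) = dist (D m) (Q 0) := fun m =>
        min_eq_right (hQ m 0)
      have h2 : 1 / (n : ℝ) * ∑ m, min 1 (dist (D m) (Q 0)) = avgDist D (Q 0) := by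
        simp only [h1, avgDist]
      have h3 : (1 / (n : ℝ) * ∑ m, min 1 (dist (D m) (Q 0)) + ω ()) - avgDist D (Q 0) = ω () := by
        rw [h2]; ring
      exact (congrArg abs h3).le.trans (hω ())

lemma L1Cube.dist_eq {ℓ : ℕ} (x y : L1Cube ℓ) : dist x y = ∑ i, |x.1 i - y.1 i| := by
  rw [Subtype.dist_eq, PiLp.dist_eq_of_L1]
  rfl

lemma L1Cube.measurable_coord {ℓ : ℕ} (i : Fin ℓ) : Measurable fun x : L1Cube ℓ => x.1 i := by
  fun_prop

/-- For `n = ℓ = 1` the noisy data point itself is released. The distance is 1-Lipschitz in that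
point, so one noise value controls all queries. -/
lemma exists_offline_single {ε β : ℝ} (hε : 0 < ε) (hβ : 0 < β) (hβ1 : β < 1) :
    ∃ M : OfflineMechanism 1 (L1Cube 1), M.IsMeasurable ∧ M.IsDifferentiallyPrivate ε 0 ∧
      M.IsAccurate (min 1 (Real.log (1 / β) / ε)) β := by
  have hb : ∀ _ : Unit, 0 < 1 / ε := fun _ => by positivity
  have hlog : 0 ≤ Real.log (1 / β) := Real.log_nonneg (by rw [le_div_iff₀ hβ]; linarith)
  have he : Measurable fun p : (Unit → ℝ) × L1Cube 1 => clamp |p.1 () - p.2.1 0| :=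
    continuous_clamp.measurable.comp
      ((((measurable_pi_apply ()).comp measurable_fst).sub
        ((L1Cube.measurable_coord 0).comp measurable_snd)).abs)
  refine ⟨laplaceOffline hb (fun D _ => (D 0).1 0) (eval := fun z y => clamp |z () - y.1 0|) he,
    isMeasurable_laplaceOffline _ _ _, isDifferentiallyPrivate_laplaceOffline _ _ ?_,
    isAccurate_laplaceOffline _ _ fun D => ?_⟩
  · intro D₁ D₂ _
    simp only [Finset.univ_unique, Finset.sum_singleton, div_div_eq_mul_div, div_one]
    have h1 := (D₁ 0).2 0
    have h2 := (D₂ 0).2 0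
    exact mul_le_of_le_one_left hε.le
      (abs_le.2 ⟨by linarith [h1.1, h2.2], by linarith [h1.2, h2.1]⟩)
  · refine holdsExceptWithProb_laplacePi hb (T := fun _ => Real.log (1 / β) / ε)
      (fun _ => by positivity) ?_ fun ω hω y hy => ?_
    · simp only [Finset.univ_unique, Finset.sum_singleton]
      rw [div_div_div_cancel_right₀ hε.ne', div_one, one_div, Real.log_inv, neg_neg,
        Real.exp_log hβ]
    · refine abs_clamp_sub_le (avgDist_nonneg _ _) (avgDist_le_one hy) ?_
      have h1 : avgDist D y = |(D 0).1 0 - y.1 0| := by simp [avgDist, L1Cube.dist_eq]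
      rw [h1]
      refine (abs_abs_sub_abs_le _ _).trans ?_
      have h2 : ((fun _ => (D 0).1 0) + ω : Unit → ℝ) () - y.1 0 - ((D 0).1 0 - y.1 0) = ω () := by
        simp only [Pi.add_apply]; ring
      rw [h2]
      exact hω ()

/-! ### The mechanism for the cube -/

/-- The average of the coefficients of all coordinates. -/
noncomputable def cubeCoeff {ℓ n : ℕ} (h : ℕ) (D : Fin n → L1Cube ℓ) (p : Fin ℓ × DyadicIndex h) :
    ℝ :=
  1 / (n : ℝ) * ∑ m, distCoeff h ((D m).1 p.1) p.2

/-- The estimate of the average distance from given coefficients. -/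
noncomputable def cubeEval {ℓ : ℕ} (h : ℕ) (z : Fin ℓ × DyadicIndex h → ℝ) (y : L1Cube ℓ) : ℝ :=
  clamp (∑ i, (y.1 i + ∑ a, z (i, a) * distBasis h (y.1 i) a))

lemma measurable_distBasis (h : ℕ) (a : DyadicIndex h) : Measurable fun t => distBasis h t a := by
  have := continuous_hat
  rcases a with _ | ⟨j, k⟩ <;> simp only [distBasis] <;> fun_prop

lemma measurable_cubeEval (ℓ h : ℕ) :
    Measurable fun p : (Fin ℓ × DyadicIndex h → ℝ) × L1Cube ℓ => cubeEval h p.1 p.2 := by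
  refine continuous_clamp.measurable.comp (Finset.measurable_fun_sum _ fun i _ => ?_)
  have h1 : Measurable fun p : (Fin ℓ × DyadicIndex h → ℝ) × L1Cube ℓ => p.2.1 i :=
    (L1Cube.measurable_coord i).comp measurable_snd
  exact h1.add (Finset.measurable_fun_sum _ fun a _ =>
    ((measurable_pi_apply _).comp measurable_fst).mul ((measurable_distBasis h a).comp h1))

/-- Each coordinate has weighted change at most `5`; averaging divides it by `n`, and the factor `5
ℓ / (n ε)` leaves each coordinate a budget of `ε / ℓ`. -/
lemma sensitivity_cubeCoeff_le {ℓ n h : ℕ} {ε : ℝ} (hℓ : 0 < ℓ) (hn : 0 < n) (hε : 0 < ε)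
    {D₁ D₂ : Fin n → L1Cube ℓ} (hD : Adjacent D₁ D₂) :
    ∑ p, |cubeCoeff h D₁ p - cubeCoeff h D₂ p| / (5 * ℓ / (n * ε) * dyadicScale h p.2) ≤ ε := by
  have hn' : (0 : ℝ) < n := by exact_mod_cast hn
  have hℓ' : (0 : ℝ) < ℓ := by exact_mod_cast hℓ
  refine sensitivity_average_le (c := fun (x : L1Cube ℓ) (p : Fin ℓ × DyadicIndex h) =>
    distCoeff h (x.1 p.1) p.2) (fun p => mul_pos (by positivity) (dyadicScale_pos h p.2)) hε.le hn
    (fun x y => ?_) hD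
  rw [Fintype.sum_prod_type]
  have h1 : ∀ i, ∑ a, |distCoeff h (x.1 i) a - distCoeff h (y.1 i) a| /
      (5 * ℓ / (n * ε) * dyadicScale h a) ≤ n * ε / ℓ := fun i => by
    have h2 := sum_abs_distCoeff_sub_le h (x.2 i) (y.2 i)
    calc _ = n * ε / (5 * ℓ) *
          ∑ a, |distCoeff h (x.1 i) a - distCoeff h (y.1 i) a| / dyadicScale h a := by
          rw [Finset.mul_sum]
          refine Finset.sum_congr rfl fun a _ => ?_
          have := (dyadicScale_pos h a).ne'
          field_simp
      _ ≤ n * ε / (5 * ℓ) * 5 := mul_le_mul_of_nonneg_left h2 (by positivity)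
      _ = n * ε / ℓ := by field_simp
  refine (Finset.sum_le_sum fun i _ => h1 i).trans_eq ?_
  simp only [Finset.sum_const, Finset.card_univ, Fintype.card_fin, nsmul_eq_mul]
  field_simp

/-- Per coordinate, truncation costs at most `s` and noise at most `s (5 lam + 24)`, whence the
`25`. -/
lemma abs_cubeEval_sub_le {ℓ n h : ℕ} (hn : 0 < n) {s lam : ℝ} (hs : (1 / 2) ^ h ≤ s)
    (hlam : 0 ≤ lam) {D : Fin n → L1Cube ℓ} {ω : Fin ℓ × DyadicIndex h → ℝ}
    (hω : ∀ p, |ω p| ≤ s * dyadicScale h p.2 * (lam + dyadicTail h p.2)) {y : L1Cube ℓ}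
    (hy : ∀ i, dist (D i) y ≤ 1) :
    |cubeEval h (cubeCoeff h D + ω) y - avgDist D y| ≤ min 1 (ℓ * (s * (5 * lam + 25))) := by
  have hn' : (0 : ℝ) < n := by exact_mod_cast hn
  have hs0 : 0 ≤ s := le_trans (by positivity) hs
  refine abs_clamp_sub_le (avgDist_nonneg _ _) (avgDist_le_one hy) ?_
  have havg : ∀ i, y.1 i + ∑ a, cubeCoeff h D (i, a) * distBasis h (y.1 i) a =
      1 / (n : ℝ) * ∑ m, (y.1 i + ∑ a, distCoeff h ((D m).1 i) a * distBasis h (y.1 i) a) := by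
    intro i
    rw [Finset.sum_add_distrib, mul_add, Finset.sum_comm]
    simp only [cubeCoeff, Finset.sum_const, Finset.card_univ, Fintype.card_fin, nsmul_eq_mul]
    rw [Finset.mul_sum Finset.univ _ (1 / (n : ℝ))]
    congr 1
    · field_simp
    · refine Finset.sum_congr rfl fun a _ => ?_
      rw [mul_assoc, Finset.sum_mul]
  have hdist : avgDist D y = ∑ i, 1 / (n : ℝ) * ∑ m, |(D m).1 i - y.1 i| := by
    simp only [avgDist, L1Cube.dist_eq]
    rw [Finset.sum_comm, Finset.mul_sum]
  have hcoord : ∀ i, |y.1 i + (∑ a, (cubeCoeff h D + ω) (i, a) * distBasis h (y.1 i) a) -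
      1 / (n : ℝ) * (∑ m, |(D m).1 i - y.1 i|)| ≤ s * (5 * lam + 25) := by
    intro i
    have hsplit : y.1 i + (∑ a, (cubeCoeff h D + ω) (i, a) * distBasis h (y.1 i) a) -
        1 / (n : ℝ) * ∑ m, |(D m).1 i - y.1 i| =
        1 / (n : ℝ) * ∑ m, (y.1 i + (∑ a, distCoeff h ((D m).1 i) a * distBasis h (y.1 i) a) -
          |(D m).1 i - y.1 i|) + ∑ a, ω (i, a) * distBasis h (y.1 i) a := by
      rw [Finset.sum_sub_distrib, mul_sub, ← havg]
      simp only [Pi.add_apply, add_mul, Finset.sum_add_distrib]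
      ring
    rw [hsplit]
    have h1 : |1 / (n : ℝ) * ∑ m, (y.1 i + (∑ a, distCoeff h ((D m).1 i) a *
        distBasis h (y.1 i) a) - |(D m).1 i - y.1 i|)| ≤ s := by
      rw [abs_mul, abs_of_nonneg (by positivity), one_div_mul_eq_div, div_le_iff₀' hn']
      refine (Finset.abs_sum_le_sum_abs _ _).trans ((Finset.sum_le_sum fun m _ =>
        (abs_distCoeff_sub_dist_le h ((D m).2 i) (y.2 i)).trans hs).trans_eq ?_)
      simp
    have h2 := abs_sum_noise_le h (y.2 i) hs0 hlam (fun a => hω (i, a))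
    refine (abs_add_le _ _).trans ((add_le_add h1 h2).trans_eq ?_)
    ring
  rw [hdist, ← Finset.sum_sub_distrib]
  refine (Finset.abs_sum_le_sum_abs _ _).trans
    ((Finset.sum_le_sum fun i _ => hcoord i).trans_eq ?_)
  simp

/-- The additive error of the mechanism for the cube. -/
noncomputable def cubeError (ℓ n : ℕ) (ε β : ℝ) : ℝ :=
  ℓ * (5 * ℓ / (n * ε) * (5 * Real.log (ℓ / β) + 25))

lemma exists_cube_mechanisms {ℓ n : ℕ} {ε β : ℝ} (hℓ : 0 < ℓ) (hn : 0 < n) (hε : 0 < ε)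
    (hβ : 0 < β) (hβ1 : β < 1) :
    (∃ M : OfflineMechanism n (L1Cube ℓ), M.IsMeasurable ∧ M.IsDifferentiallyPrivate ε 0 ∧
      M.IsAccurate (min 1 (cubeError ℓ n ε β)) β) ∧
    ∀ k, ∃ M : InteractiveMechanism n (L1Cube ℓ), M.IsMeasurable ∧
      M.IsDifferentiallyPrivate k ε 0 ∧ M.IsAccurate k (min 1 (cubeError ℓ n ε β)) β := by
  have hn' : (0 : ℝ) < n := by exact_mod_cast hn
  have hℓ' : (1 : ℝ) ≤ ℓ := by exact_mod_cast hℓ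
  have hℓ0 : (0 : ℝ) < ℓ := by linarith
  have hs : 0 < 5 * ℓ / (n * ε) := by positivity
  -- The depth only has to push truncation below one noise unit, since no other bound depends on it.
  obtain ⟨h, hh⟩ := exists_pow_lt_of_lt_one hs (by norm_num : (1 / 2 : ℝ) < 1)
  have hlam : 0 ≤ Real.log (ℓ / β) := Real.log_nonneg (by rw [le_div_iff₀ hβ]; linarith)
  have hb : ∀ p : Fin ℓ × DyadicIndex h, 0 < 5 * ℓ / (n * ε) * dyadicScale h p.2 :=
    fun p => mul_pos hs (dyadicScale_pos h p.2)
  have hacc : ∀ D : Fin n → L1Cube ℓ, HoldsExceptWithProb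
      (laplacePi fun p : Fin ℓ × DyadicIndex h => 5 * ℓ / (n * ε) * dyadicScale h p.2)
      (fun ω => ∀ y, (∀ i, dist (D i) y ≤ 1) →
        |cubeEval h (cubeCoeff h D + ω) y - avgDist D y| ≤ min 1 (cubeError ℓ n ε β)) β := by
    intro D
    refine holdsExceptWithProb_laplacePi hb
      (T := fun p => 5 * ℓ / (n * ε) * dyadicScale h p.2 * (Real.log (ℓ / β) + dyadicTail h p.2))
      (fun p => mul_nonneg (hb p).le (add_nonneg hlam (dyadicTail_nonneg h p.2))) ?_
      fun ω hω y hy => abs_cubeEval_sub_le hn hh.le hlam hω hy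
    -- Each tail is `β / ℓ` times a weight; the weights of one coordinate sum to at most `1`, so the
    -- union over `ℓ` coordinates costs at most `β`.
    have h1 : ∀ p : Fin ℓ × DyadicIndex h,
        Real.exp (-(5 * ℓ / (n * ε) * dyadicScale h p.2 *
          (Real.log (ℓ / β) + dyadicTail h p.2) / (5 * ℓ / (n * ε) * dyadicScale h p.2))) =
        β / ℓ * Real.exp (-dyadicTail h p.2) := fun p => by
      rw [mul_div_cancel_left₀ _ (hb p).ne', neg_add, Real.exp_add, Real.exp_neg (Real.log _),
        Real.exp_log (by positivity), inv_div]
    rw [Finset.sum_congr rfl fun p _ => h1 p, ← Finset.mul_sum, Fintype.sum_prod_type]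
    simp only [Finset.sum_const, Finset.card_univ, Fintype.card_fin, nsmul_eq_mul]
    rw [← mul_assoc, div_mul_cancel₀ _ hℓ0.ne']
    exact mul_le_of_le_one_right hβ.le (sum_exp_neg_dyadicTail_le h)
  have he := measurable_cubeEval ℓ h
  exact ⟨⟨laplaceOffline hb (cubeCoeff h) he, isMeasurable_laplaceOffline _ _ _,
      isDifferentiallyPrivate_laplaceOffline _ _ fun _ _ => sensitivity_cubeCoeff_le hℓ hn hε,
      isAccurate_laplaceOffline _ _ hacc⟩,
    fun k => ⟨laplaceInteractive hb (cubeCoeff h) he, isMeasurable_laplaceInteractive _ _ _,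
      isDifferentiallyPrivate_laplaceInteractive _ _ k
        fun _ _ => sensitivity_cubeCoeff_le hℓ hn hε,
      isAccurate_laplaceInteractive _ _ k hacc⟩⟩

/-! ### Comparison of the error bounds -/

/-- If `w ≤ 1`, then `w ≤ w ^ p`; otherwise the right side is already at least `1`. -/
lemma min_one_mul_le {K w p : ℝ} (hK : 1 ≤ K) (hw : 0 ≤ w) (hp0 : 0 ≤ p) (hp1 : p ≤ 1) :
    min 1 (K * w) ≤ K * w ^ p := by
  rcases le_total w 1 with h | h
  · refine (min_le_right _ _).trans (mul_le_mul_of_nonneg_left ?_ (by linarith))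
    rcases hw.eq_or_lt with rfl | hw
    · positivity
    · simpa using Real.rpow_le_rpow_of_exponent_ge hw h hp1
  · refine (min_le_left _ _).trans ?_
    nlinarith [Real.one_le_rpow h hp0]

/-- The exponent `9/4` is fixed by `9/4 * 4/5 = 9/5`; the power `2/3` then gives `ℓ ^ (3/2)`, below
`ℓ ^ (7/3)`. The factor `log (4 / δ)` exceeds `1` and only helps. -/
lemma min_one_le_errors {ℓ n r : ℕ} {ε β E : ℝ} (hℓ : 0 < ℓ) (hn : 0 < n) (hε : 0 < ε)
    (hL : 0 ≤ Real.log (r / β))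
    (hE : E ≤ 375 * ((ℓ : ℝ) ^ (9 / 4 : ℝ) * Real.log (r / β) / (n * ε))) :
    min 1 E ≤ pureError 375 ℓ n r ε β ∧
      ∀ δ : ℝ, 0 < δ → δ < 1 → min 1 E ≤ approxError 375 ℓ n r ε δ β := by
  have hn' : (0 : ℝ) < n := by exact_mod_cast hn
  have hℓ' : (1 : ℝ) ≤ ℓ := by exact_mod_cast hℓ
  have hℓ0 : (0 : ℝ) ≤ ℓ := by linarith
  set L := Real.log (r / β) with hLdef
  have hw : 0 ≤ (ℓ : ℝ) ^ (9 / 4 : ℝ) * L / (n * ε) := by positivity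
  have hpow : ∀ p : ℝ, ((ℓ : ℝ) ^ (9 / 4 : ℝ) * L / (n * ε)) ^ p =
      (ℓ : ℝ) ^ (9 / 4 * p) * L ^ p / ((n : ℝ) ^ p * ε ^ p) := fun p => by
    rw [Real.div_rpow (by positivity) (by positivity), Real.mul_rpow (by positivity) hL,
      Real.mul_rpow hn'.le hε.le, ← Real.rpow_mul hℓ0]
  have hmin : ∀ p : ℝ, 0 ≤ p → p ≤ 1 →
      min 1 E ≤ 375 * ((ℓ : ℝ) ^ (9 / 4 * p) * L ^ p / ((n : ℝ) ^ p * ε ^ p)) := fun p h0 h1 => by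
    rw [← hpow]
    exact (min_le_min_left _ hE).trans (min_one_mul_le (by norm_num) hw h0 h1)
  constructor
  · refine (hmin (2 / 3) (by norm_num) (by norm_num)).trans ?_
    unfold pureError
    rw [← hLdef]
    gcongr
    norm_num
  · intro δ hδ hδ1
    refine (hmin (4 / 5) (by norm_num) (by norm_num)).trans ?_
    have h1 : 1 ≤ Real.log (4 / δ) := by
      rw [Real.le_log_iff_exp_le (by positivity)]
      have : Real.exp 1 < 4 := by linarith [Real.exp_one_lt_d9]
      rw [le_div_iff₀ hδ]
      nlinarith [Real.exp_pos 1]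
    have h2 : 1 ≤ Real.log (4 / δ) ^ (4 / 5 : ℝ) := Real.one_le_rpow h1 (by norm_num)
    unfold approxError
    rw [← hLdef, show (9 / 4 * (4 / 5) : ℝ) = 9 / 5 by norm_num]
    gcongr
    exact le_mul_of_one_le_right (by positivity) h2

/-- The extra `ℓ ^ (1/4)` absorbs `log ℓ`, and `r ≥ 2` keeps `log (r / β)` above `0.69`, so that it
absorbs the constants. -/
lemma cubeError_le {ℓ n r : ℕ} {ε β : ℝ} (hℓ : 0 < ℓ) (hn : 0 < n) (hε : 0 < ε) (hβ : 0 < β)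
    (hβ1 : β < 1) (hr : 2 ≤ r) :
    cubeError ℓ n ε β ≤ 375 * ((ℓ : ℝ) ^ (9 / 4 : ℝ) * Real.log (r / β) / (n * ε)) := by
  have hn' : (0 : ℝ) < n := by exact_mod_cast hn
  have hℓ' : (1 : ℝ) ≤ ℓ := by exact_mod_cast hℓ
  have hℓ0 : (0 : ℝ) < ℓ := by linarith
  have hr' : (2 : ℝ) ≤ r := by exact_mod_cast hr
  have ha : (1 : ℝ) ≤ (ℓ : ℝ) ^ (1 / 4 : ℝ) := Real.one_le_rpow hℓ' (by norm_num)
  have hpow : (ℓ : ℝ) ^ (9 / 4 : ℝ) = ℓ ^ 2 * (ℓ : ℝ) ^ (1 / 4 : ℝ) := by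
    rw [show (9 / 4 : ℝ) = (2 : ℕ) + 1 / 4 by norm_num, Real.rpow_add hℓ0, Real.rpow_natCast]
  have hlogℓ : Real.log ℓ ≤ 4 * (ℓ : ℝ) ^ (1 / 4 : ℝ) := by
    have := Real.log_le_rpow_div hℓ0.le (show (0 : ℝ) < 1 / 4 by norm_num)
    linarith
  have hL1 : Real.log (r / β) = Real.log r - Real.log β :=
    Real.log_div (by linarith) hβ.ne'
  have hL2 : Real.log (ℓ / β) = Real.log ℓ - Real.log β := Real.log_div hℓ0.ne' hβ.ne'
  have hlogr : 0.69 ≤ Real.log r := by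
    have := Real.log_le_log (by norm_num) hr'
    linarith [Real.log_two_gt_d9]
  have hlogβ : Real.log β ≤ 0 := Real.log_nonpos hβ.le hβ1.le
  set a := (ℓ : ℝ) ^ (1 / 4 : ℝ)
  set L := Real.log (r / β)
  have hL : 0.69 ≤ L := by linarith
  have haL : 0.69 * a ≤ a * L := by nlinarith
  have hLa : L ≤ a * L := by nlinarith
  -- The `log ℓ` part costs at most `100 / 0.69`, the `-log β` part `25` and the constant `125 /
  -- 0.69`, all in units of `a * L`; the total is below `375`.
  have key : 5 * (5 * Real.log (ℓ / β) + 25) ≤ 375 * (a * L) := by linarith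
  calc cubeError ℓ n ε β = ℓ ^ 2 / (n * ε) * (5 * (5 * Real.log (ℓ / β) + 25)) := by
        unfold cubeError; ring
    _ ≤ ℓ ^ 2 / (n * ε) * (375 * (a * L)) := mul_le_mul_of_nonneg_left key (by positivity)
    _ = _ := by rw [hpow]; ring

lemma single_error_le {ℓ n : ℕ} {ε β : ℝ} (hℓ : 0 < ℓ) (hn : 0 < n) (hε : 0 < ε) (hβ : 0 < β)
    (hβ1 : β < 1) : Real.log (1 / β) / (n * ε) ≤
      375 * ((ℓ : ℝ) ^ (9 / 4 : ℝ) * Real.log ((1 : ℕ) / β) / (n * ε)) := by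
  have hn' : (0 : ℝ) < n := by exact_mod_cast hn
  have hlog : 0 ≤ Real.log (1 / β) := Real.log_nonneg (by rw [le_div_iff₀ hβ]; linarith)
  have h1 : (1 : ℝ) ≤ (ℓ : ℝ) ^ (9 / 4 : ℝ) :=
    Real.one_le_rpow (by exact_mod_cast hℓ) (by norm_num)
  rw [Nat.cast_one, mul_div_assoc, ← mul_assoc]
  exact le_mul_of_one_le_left (by positivity) (by linarith)

/-- For at least one query, there is a pure private interactive mechanism whose error is below
both bounds. -/
lemma exists_interactive {ℓ n k : ℕ} {ε β : ℝ} (hℓ : 0 < ℓ) (hn : 0 < n) (hε : 0 < ε)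
    (hβ : 0 < β) (hβ1 : β < 1) (hk : 0 < k) :
    ∃ M : InteractiveMechanism n (L1Cube ℓ), M.IsMeasurable ∧ M.IsDifferentiallyPrivate k ε 0 ∧
      M.IsAccurate k (pureError 375 ℓ n k ε β) β ∧
      ∀ δ : ℝ, 0 < δ → δ < 1 → M.IsAccurate k (approxError 375 ℓ n k ε δ β) β := by
  have hL : 0 ≤ Real.log (k / β) := Real.log_nonneg (by
    rw [le_div_iff₀ hβ]
    have : (1 : ℝ) ≤ k := by exact_mod_cast hk
    linarith)
  obtain rfl | hk2 : k = 1 ∨ 2 ≤ k := by omega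
  · obtain ⟨M, h1, h2, h3⟩ := exists_interactive_single (X := L1Cube ℓ) hn hε hβ hβ1
    have h4 := min_one_le_errors hℓ hn hε hL (single_error_le hℓ hn hε hβ hβ1)
    exact ⟨M, h1, h2, h3.mono h4.1, fun δ hδ hδ1 => h3.mono (h4.2 δ hδ hδ1)⟩
  · obtain ⟨M, h1, h2, h3⟩ := (exists_cube_mechanisms hℓ hn hε hβ hβ1).2 k
    have h4 := min_one_le_errors hℓ hn hε hL (cubeError_le hℓ hn hε hβ hβ1 hk2)
    exact ⟨M, h1, h2, h3.mono h4.1, fun δ hδ hδ1 => h3.mono (h4.2 δ hδ hδ1)⟩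

/-- There is a pure private non-interactive mechanism whose error is below both bounds. -/
lemma exists_offline {ℓ n : ℕ} {ε β : ℝ} (hℓ : 0 < ℓ) (hn : 0 < n) (hε : 0 < ε)
    (hβ : 0 < β) (hβ1 : β < 1) :
    ∃ M : OfflineMechanism n (L1Cube ℓ), M.IsMeasurable ∧ M.IsDifferentiallyPrivate ε 0 ∧
      M.IsAccurate (pureError 375 ℓ n (n * ℓ) ε β) β ∧
      ∀ δ : ℝ, 0 < δ → δ < 1 → M.IsAccurate (approxError 375 ℓ n (n * ℓ) ε δ β) β := by
  have hr : 0 < n * ℓ := Nat.mul_pos hn hℓ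
  have hL : 0 ≤ Real.log ((n * ℓ : ℕ) / β) := Real.log_nonneg (by
    rw [le_div_iff₀ hβ]
    have : (1 : ℝ) ≤ (n * ℓ : ℕ) := by exact_mod_cast hr
    linarith)
  obtain hr1 | hr2 : n * ℓ = 1 ∨ 2 ≤ n * ℓ := by omega
  · obtain ⟨rfl, rfl⟩ := mul_eq_one.1 hr1
    obtain ⟨M, h1, h2, h3⟩ := exists_offline_single hε hβ hβ1
    have h5 := single_error_le (ℓ := 1) (n := 1) one_pos one_pos hε hβ hβ1
    rw [Nat.cast_one, one_mul] at h5
    have h4 := min_one_le_errors (r := 1 * 1) (E := Real.log (1 / β) / ε) hℓ hn hε hL (by simpa using h5)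
    exact ⟨M, h1, h2, h3.mono h4.1, fun δ hδ hδ1 => h3.mono (h4.2 δ hδ hδ1)⟩
  · obtain ⟨M, h1, h2, h3⟩ := (exists_cube_mechanisms hℓ hn hε hβ hβ1).1
    have h4 := min_one_le_errors hℓ hn hε hL (cubeError_le hℓ hn hε hβ hβ1 hr2)
    exact ⟨M, h1, h2, h3.mono h4.1, fun δ hδ hδ1 => h3.mono (h4.2 δ hδ hδ1)⟩

theorem mainTheorem8 :
    -- whatever mechanism is used for the cube, its additive error is inherited via embeddings
    (∀ (ℓ n k : ℕ) (α β : ℝ) (M : InteractiveMechanism n (L1Cube ℓ)),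
      M.IsAccurate k α β →
        InteractiveMechanism.IsAccurateViaEmbeddings.{u} M k α β) ∧
    (∀ (ℓ n : ℕ) (α β : ℝ) (M : OfflineMechanism n (L1Cube ℓ)),
      M.IsAccurate α β →
        OfflineMechanism.IsAccurateViaEmbeddings.{u} M α β) ∧
    -- and there are private mechanisms for the cube with the claimed additive errors
    ∃ K : ℝ, 0 < K ∧ ∀ (ℓ n : ℕ) (ε β : ℝ), 0 < ℓ → 0 < n → 0 < ε → 0 < β → β < 1 →
      -- interactive setting, approximate and pure differential privacy
      (∀ (k : ℕ) (δ : ℝ), 0 < k → 0 < δ → δ < 1 →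
        ∃ M : InteractiveMechanism n (L1Cube ℓ),
          M.IsMeasurable ∧ M.IsDifferentiallyPrivate k ε δ ∧
          M.IsAccurate k (approxError K ℓ n k ε δ β) β ∧
          InteractiveMechanism.IsAccurateViaEmbeddings.{u} M k (approxError K ℓ n k ε δ β) β) ∧
      (∀ k : ℕ, 0 < k →
        ∃ M : InteractiveMechanism n (L1Cube ℓ),
          M.IsMeasurable ∧ M.IsDifferentiallyPrivate k ε 0 ∧
          M.IsAccurate k (pureError K ℓ n k ε β) β ∧
          InteractiveMechanism.IsAccurateViaEmbeddings.{u} M k (pureError K ℓ n k ε β) β) ∧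
      -- non-interactive setting, approximate and pure differential privacy
      (∀ δ : ℝ, 0 < δ → δ < 1 →
        ∃ M : OfflineMechanism n (L1Cube ℓ),
          M.IsMeasurable ∧ M.IsDifferentiallyPrivate ε δ ∧
          M.IsAccurate (approxError K ℓ n (n * ℓ) ε δ β) β ∧
          OfflineMechanism.IsAccurateViaEmbeddings.{u} M
            (approxError K ℓ n (n * ℓ) ε δ β) β) ∧
      (∃ M : OfflineMechanism n (L1Cube ℓ),
          M.IsMeasurable ∧ M.IsDifferentiallyPrivate ε 0 ∧
          M.IsAccurate (pureError K ℓ n (n * ℓ) ε β) β ∧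
          OfflineMechanism.IsAccurateViaEmbeddings.{u} M (pureError K ℓ n (n * ℓ) ε β) β) := by
  refine ⟨fun _ _ _ _ _ _ h => h.viaEmbeddings, fun _ _ _ _ _ h => h.viaEmbeddings, 375,
    by norm_num, fun ℓ n ε β hℓ hn hε hβ hβ1 => ⟨fun k δ hk hδ hδ1 => ?_, fun k hk => ?_,
      fun δ hδ hδ1 => ?_, ?_⟩⟩
  · obtain ⟨M, h1, h2, _, h4⟩ := exists_interactive (k := k) hℓ hn hε hβ hβ1 hk
    -- A purely private mechanism already meets the approximate bound, and increasing `δ` from `0`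
    -- only weakens privacy.
    exact ⟨M, h1, fun analyst ha D₁ D₂ h => (h2 analyst ha D₁ D₂ h).mono hδ.le, h4 δ hδ hδ1,
      (h4 δ hδ hδ1).viaEmbeddings⟩
  · obtain ⟨M, h1, h2, h3, _⟩ := exists_interactive (k := k) hℓ hn hε hβ hβ1 hk
    exact ⟨M, h1, h2, h3, h3.viaEmbeddings⟩
  · obtain ⟨M, h1, h2, _, h4⟩ := exists_offline hℓ hn hε hβ hβ1
    exact ⟨M, h1, fun D₁ D₂ h => (h2 D₁ D₂ h).mono hδ.le, h4 δ hδ hδ1,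
      (h4 δ hδ hδ1).viaEmbeddings⟩
  · obtain ⟨M, h1, h2, h3, _⟩ := exists_offline hℓ hn hε hβ hβ1
    exact ⟨M, h1, h2, h3, h3.viaEmbeddings⟩
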